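/- Let $\mathcal P=\langle\Sigma\mid\mathcal R\rangle$ be a semigroup presentation ($\mathcal R$ is a set of pairs of words of $\Sigma^+$ such that $u=v\in\mathcal R$ implies $v=u\notin\mathcal R$), and let $w\in\Sigma^+$. Semigroup diagrams over $\mathcal P$ are considered up to isotopy; $\epsilon(x)$ is the trivial diagram on a (possibly empty) word $x$, $\Delta_1\circ\Delta_2$ denotes concatenation, $\Delta_1\cdot\Delta_2$ the reduced form of $\Delta_1\circ\Delta_2$, $\Delta_1+\Delta_2$ the sum, $\Delta^{-1}$ the mirror image, and $\Delta\le D$ means that $\Delta$ is a prefix of $D$, i.e. $D=\Delta\circ E$ for some $E$. A diagram with one cell is atomic, and a diagram is thin if it is a sum of atomic diagrams (or trivial). The diagram group $D(\mathcal P,x)$ consists of the reduced $(x,x)$-diagrams with the product $\cdot$. The Farley complex $X(\mathcal P,w)$ is the cube complex whose vertices are the reduced diagrams with top label $w$ and whose $n$-cubes are spanned by the sets $\{V\cdot Q\mid Q\le\Gamma\}$, where $V$ is a vertex and $\Gamma$ a thin diagram with $n$ cells and $\mathrm{top}(\Gamma)=\mathrm{bot}(V)$; $D(\mathcal P,w)$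 acts on it by left multiplication. A hyperplane is a class of edges for the equivalence relation generated by being parallel sides of a square. For a hyperplane $J$, let $J^+$ be the halfspace of $J$ (connected component of the complex cut along $J$) that does not contain $\epsilon(w)$. A diagram is minimal if its maximal thin suffix has exactly one cell, and the minimal diagram associated with $J$ is the minimal reduced diagram $\Delta$ with $J^+=\{D\mid\Delta\le D\}$. **Proposition 2.6.** Let $J$ be a hyperplane of $X(\mathcal P,w)$ and $\Delta$ its associated minimal diagram. Write the maximal thin suffix of $\Delta$ as $F=\epsilon(a)+\Pi+\epsilon(b)$, where $a,b$ are possibly empty words and $\Pi$ is a single $(u,v)$-cell ($u=v$ or $v=u$ belongs to $\mathcal R$), and let $\overline\Delta$ be the diagram obtained from $\Delta$ by removing $F$, so that $\Delta=\overline\Delta\circ F$, $\mathrm{bot}(\overline\Delta)=aub$ and $\mathrm{bot}(\Delta)=avb$. Suppose that there is no word $\xi\in\Sigma^+$ with $a=au\xi$ modulo $\mathcal P$. Then $$\mathrm{stab}(J)=\overline\Delta\cdot\bigl(D(\mathcal P,a)\times D(\mathcal P,b)\bigr)\cdot\overline\Delta^{-1},$$ where $\mathrm{stab}(J)$ is the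 stabilizer of $J$ in $D(\mathcal P,w)$ and $D(\mathcal P,a)\times D(\mathcal P,b)$ is the canonical subgroup of $D(\mathcal P,aub)$, the image of the injective homomorphism $(A,B)\mapsto A+\epsilon(u)+B$. -/

import Mathlib

/-- A semigroup presentation `⟨α | rel⟩`: the relations are pairs of nonempty words, and at most
one of `u = v`, `v = u` is a relation (in particular `u = u` never is).  Words are lists, the
free semigroup `α⁺` consists of the nonempty ones. -/
structure SemigroupPresentation (α : Type*) where
  rel : Set (List α × List α)
  ne_nil : ∀ {u v : List α}, (u, v) ∈ rel → u ≠ [] ∧ v ≠ []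
  asymm : ∀ {u v : List α}, (u, v) ∈ rel → (v, u) ∉ rel

/-- An elementary derivation step `left · top · right ⟶ left · bot · right`; it is the picture
`ε(left) + Π + ε(right)` of a single cell `Π` with top label `top` and bottom label `bot`. -/
@[ext] structure DerivStep (α : Type*) where
  left : List α
  top : List α
  bot : List α
  right : List α

namespace DerivStep

variable {α : Type*}

def inv (e : DerivStep α) : DerivStep α := ⟨e.left, e.bot, e.top, e.right⟩

def addRight (z : List α) (e : DerivStep α) : DerivStep α := ⟨e.left, e.top, e.bot, e.right ++ z⟩

def addLeft (z : List α) (e : DerivStep α) : DerivStep α := ⟨z ++ e.left, e.top, e.bot, e.right⟩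

/-- Two consecutive steps that act on disjoint subwords are performed in the other order.  The
associated planar diagrams are isotopic. -/
inductive Exchange : List (DerivStep α) → List (DerivStep α) → Prop
  | mk (L M : List (DerivStep α)) (p u v q u' v' r : List α) :
      Exchange (L ++ ⟨p, u, v, q ++ u' ++ r⟩ :: ⟨p ++ v ++ q, u', v', r⟩ :: M)
        (L ++ ⟨p ++ u ++ q, u', v', r⟩ :: ⟨p, u, v, q ++ v' ++ r⟩ :: M)

theorem Exchange.append {L M : List (DerivStep α)} (h : Exchange L M) (A B : List (DerivStep α)) :
    Exchange (A ++ L ++ B) (A ++ M ++ B) := by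
  cases h with
  | mk L M p u v q u' v' r =>
    simpa using Exchange.mk (A ++ L) (M ++ B) p u v q u' v' r

theorem Exchange.map_addRight {L M : List (DerivStep α)} (h : Exchange L M) (z : List α) :
    Exchange (L.map (addRight z)) (M.map (addRight z)) := by
  cases h with
  | mk L M p u v q u' v' r =>
    simpa [addRight] using
      Exchange.mk (L.map (addRight z)) (M.map (addRight z)) p u v q u' v' (r ++ z)

theorem Exchange.map_addLeft {L M : List (DerivStep α)} (h : Exchange L M) (z : List α) :
    Exchange (L.map (addLeft z)) (M.map (addLeft z)) := by
  cases h with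
  | mk L M p u v q u' v' r =>
    simpa [addLeft] using
      Exchange.mk (L.map (addLeft z)) (M.map (addLeft z)) (z ++ p) u v q u' v' r

theorem Exchange.mirror {L M : List (DerivStep α)} (h : Exchange L M) :
    Exchange (M.map inv).reverse (L.map inv).reverse := by
  cases h with
  | mk L M p u v q u' v' r =>
    simpa [inv] using
      Exchange.mk (M.map inv).reverse (L.map inv).reverse p v u q v' u' r

theorem Exchange.length {L M : List (DerivStep α)} (h : Exchange L M) : L.length = M.length := by
  cases h; simp

end DerivStep

namespace SemigroupPresentation

open DerivStep

variable {α : Type*} (P : SemigroupPresentation α)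

/-- There is a `(u, v)`-cell: `u = v` or `v = u` is a relation. -/
def IsCell (u v : List α) : Prop := (u, v) ∈ P.rel ∨ (v, u) ∈ P.rel

/-- Equality of words modulo `P`: the congruence generated by the relations.  (As both sides of
every relation are nonempty, the empty word is only equal to itself.) -/
def EqMod (x y : List α) : Prop :=
  conGen (fun s t : FreeMonoid α => (s.toList, t.toList) ∈ P.rel)
    (FreeMonoid.ofList x) (FreeMonoid.ofList y)

theorem IsCell.symm {P : SemigroupPresentation α} {u v : List α} (h : P.IsCell u v) :
    P.IsCell v u := Or.symm h

theorem IsCell.ne {P : SemigroupPresentation α} {u v : List α} (h : P.IsCell u v) : u ≠ v := by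
  rintro rfl
  rcases h with h | h <;> exact P.asymm h h

/-- `L` is a derivation over `P` from the word `x` to the word `y`. -/
def IsDerivation : List α → List (DerivStep α) → List α → Prop
  | x, [], y => x = y
  | x, e :: L, y => P.IsCell e.top e.bot ∧ x = e.left ++ e.top ++ e.right ∧
      IsDerivation (e.left ++ e.bot ++ e.right) L y

theorem IsDerivation.append {P : SemigroupPresentation α} {x y z : List α}
    {L M : List (DerivStep α)} (hL : P.IsDerivation x L y) (hM : P.IsDerivation y M z) :
    P.IsDerivation x (L ++ M) z := by
  induction L generalizing x with
  | nil => cases hL; exact hM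
  | cons e L ih => exact ⟨hL.1, hL.2.1, ih hL.2.2⟩

theorem IsDerivation.addRight {P : SemigroupPresentation α} {x y : List α}
    {L : List (DerivStep α)} (h : P.IsDerivation x L y) (z : List α) :
    P.IsDerivation (x ++ z) (L.map (DerivStep.addRight z)) (y ++ z) := by
  induction L generalizing x with
  | nil => cases h; rfl
  | cons e L ih =>
    obtain ⟨h1, rfl, h3⟩ := h
    exact ⟨h1, by simp [DerivStep.addRight], by simpa [DerivStep.addRight] using ih h3⟩

theorem IsDerivation.addLeft {P : SemigroupPresentation α} {x y : List α}
    {L : List (DerivStep α)} (h : P.IsDerivation x L y) (z : List α) :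
    P.IsDerivation (z ++ x) (L.map (DerivStep.addLeft z)) (z ++ y) := by
  induction L generalizing x with
  | nil => cases h; rfl
  | cons e L ih =>
    obtain ⟨h1, rfl, h3⟩ := h
    exact ⟨h1, by simp [DerivStep.addLeft], by simpa [DerivStep.addLeft] using ih h3⟩

theorem IsDerivation.mirror {P : SemigroupPresentation α} {x y : List α}
    {L : List (DerivStep α)} (h : P.IsDerivation x L y) :
    P.IsDerivation y (L.map DerivStep.inv).reverse x := by
  induction L generalizing x with
  | nil => cases h; rfl
  | cons e L ih =>
    obtain ⟨h1, rfl, h3⟩ := h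
    rw [List.map_cons, List.reverse_cons]
    exact (ih h3).append ⟨h1.symm, rfl, rfl⟩

/-- Semigroup `(x, y)`-diagrams over `P`, up to isotopy.  Every semigroup diagram is a
concatenation of atomic diagrams, i.e. it is drawn by a derivation; two derivations draw isotopic
diagrams exactly when one is turned into the other by exchanging consecutive independent steps. -/
def Diagram (x y : List α) : Type _ :=
  Quot fun L M : {L : List (DerivStep α) // P.IsDerivation x L y} => Exchange L.1 M.1

namespace Diagram

variable {P}

/-- The trivial diagram `ε(x)`. -/
def trivial (P : SemigroupPresentation α) (x : List α) : P.Diagram x x := Quot.mk _ ⟨[], rfl⟩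

/-- The diagram that consists of a single `(u, v)`-cell. -/
def cell {u v : List α} (h : P.IsCell u v) : P.Diagram u v :=
  Quot.mk _ ⟨[⟨[], u, v, []⟩], h, by simp, by simp [IsDerivation]⟩

/-- The number of cells. -/
def numCells {x y : List α} (D : P.Diagram x y) : ℕ :=
  Quot.lift (fun L => L.1.length) (fun _ _ h => h.length) D

/-- The concatenation `D ∘ E`: the bottom path of `D` is glued to the top path of `E`. -/
def comp {x y z : List α} (D : P.Diagram x y) (E : P.Diagram y z) : P.Diagram x z :=
  Quot.map₂ (fun L M => ⟨L.1 ++ M.1, L.2.append M.2⟩)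
    (fun L _ _ h => by simpa using h.append L.1 [])
    (fun _ _ M h => by simpa using h.append [] M.1) D E

/-- `D + ε(z)`. -/
def addTrivial {x y : List α} (D : P.Diagram x y) (z : List α) : P.Diagram (x ++ z) (y ++ z) :=
  Quot.map (fun L => ⟨L.1.map (DerivStep.addRight z), L.2.addRight z⟩)
    (fun _ _ h => h.map_addRight z) D

/-- `ε(z) + D`. -/
def trivialAdd (z : List α) {x y : List α} (D : P.Diagram x y) : P.Diagram (z ++ x) (z ++ y) :=
  Quot.map (fun L => ⟨L.1.map (DerivStep.addLeft z), L.2.addLeft z⟩)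
    (fun _ _ h => h.map_addLeft z) D

/-- The sum `D + E`: the rightmost vertex of `D` is glued to the leftmost vertex of `E`.  It is
drawn by first drawing `D` and then `E`. -/
def sum {x y x' y' : List α} (D : P.Diagram x y) (E : P.Diagram x' y') :
    P.Diagram (x ++ x') (y ++ y') :=
  (D.addTrivial x').comp (trivialAdd y E)

/-- The mirror image of `D`. -/
def mirror {x y : List α} (D : P.Diagram x y) : P.Diagram y x :=
  Quot.lift (fun L => Quot.mk _ ⟨(L.1.map DerivStep.inv).reverse, L.2.mirror⟩)
    (fun L M h => by
      refine (Quot.sound ?_).symm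
      exact h.mirror) D

theorem comp_assoc {x y z t : List α} (A : P.Diagram x y) (B : P.Diagram y z)
    (C : P.Diagram z t) : (A.comp B).comp C = A.comp (B.comp C) := by
  induction A using Quot.ind
  induction B using Quot.ind
  induction C using Quot.ind
  exact congrArg (Quot.mk _) (Subtype.ext (by simp))

theorem trivial_comp {x y : List α} (A : P.Diagram x y) : (trivial P x).comp A = A := by
  induction A using Quot.ind
  rfl

theorem comp_trivial {x y : List α} (A : P.Diagram x y) : A.comp (trivial P y) = A := by
  induction A using Quot.ind
  exact congrArg (Quot.mk _) (Subtype.ext (by simp))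

theorem comp_addTrivial {x y z : List α} (A : P.Diagram x y) (B : P.Diagram y z) (s : List α) :
    (A.comp B).addTrivial s = (A.addTrivial s).comp (B.addTrivial s) := by
  induction A using Quot.ind
  induction B using Quot.ind
  exact congrArg (Quot.mk _) (Subtype.ext (by simp))

theorem trivialAdd_comp {x y z : List α} (A : P.Diagram x y) (B : P.Diagram y z) (s : List α) :
    trivialAdd s (A.comp B) = (trivialAdd s A).comp (trivialAdd s B) := by
  induction A using Quot.ind
  induction B using Quot.ind
  exact congrArg (Quot.mk _) (Subtype.ext (by simp))

theorem mirror_addTrivial {x y : List α} (A : P.Diagram x y) (s : List α) :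
    (A.addTrivial s).mirror = A.mirror.addTrivial s := by
  induction A using Quot.ind
  exact congrArg (Quot.mk _) (Subtype.ext (by
    simp [Function.comp_def, DerivStep.inv, DerivStep.addRight]))

theorem mirror_trivialAdd {x y : List α} (A : P.Diagram x y) (s : List α) :
    (trivialAdd s A).mirror = trivialAdd s A.mirror := by
  induction A using Quot.ind
  exact congrArg (Quot.mk _) (Subtype.ext (by
    simp [Function.comp_def, DerivStep.inv, DerivStep.addLeft]))

theorem mirror_comp {x y z : List α} (A : P.Diagram x y) (B : P.Diagram y z) :
    (A.comp B).mirror = B.mirror.comp A.mirror := by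
  induction A using Quot.ind
  induction B using Quot.ind
  exact congrArg (Quot.mk _) (Subtype.ext (by simp))

theorem mirror_mirror {x y : List α} (A : P.Diagram x y) : A.mirror.mirror = A := by
  induction A using Quot.ind
  exact congrArg (Quot.mk _) (Subtype.ext (by simp [Function.comp_def, DerivStep.inv]))

theorem numCells_mirror {x y : List α} (A : P.Diagram x y) : A.mirror.numCells = A.numCells := by
  induction A using Quot.ind
  simp [mirror, numCells]

theorem numCells_addTrivial {x y : List α} (A : P.Diagram x y) (s : List α) :
    (A.addTrivial s).numCells = A.numCells := by
  induction A using Quot.ind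
  simp [addTrivial, numCells, Quot.map]

theorem numCells_trivialAdd {x y : List α} (A : P.Diagram x y) (s : List α) :
    (trivialAdd s A).numCells = A.numCells := by
  induction A using Quot.ind
  simp [trivialAdd, numCells, Quot.map]

/-- An atomic diagram has distinct top and bottom labels. -/
theorem ne_of_numCells_eq_one {x y : List α} (A : P.Diagram x y) (h : A.numCells = 1) :
    x ≠ y := by
  induction A using Quot.ind with
  | mk L =>
    obtain ⟨L, hL⟩ := L
    obtain ⟨e, rfl⟩ := List.length_eq_one_iff.1 h
    obtain ⟨h1, rfl, h3⟩ := hL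
    rintro rfl
    simp only [IsDerivation, List.append_assoc, List.append_cancel_left_eq,
      List.append_cancel_right_eq] at h3
    exact h1.ne h3.symm

/-- Sums satisfy the interchange law. -/
theorem addTrivial_comp_trivialAdd {x y x' y' : List α} (A : P.Diagram x y)
    (B : P.Diagram x' y') :
    (A.addTrivial x').comp (trivialAdd y B) = (trivialAdd x B).comp (A.addTrivial y') := by
  induction A using Quot.ind with
  | mk L =>
  induction B using Quot.ind with
  | mk M =>
  obtain ⟨L, hL⟩ := L
  obtain ⟨M, hM⟩ := M
  suffices H : ∀ (M : List (DerivStep α)) (x' : List α) (hM : P.IsDerivation x' M y')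
      (y : List α) (L : List (DerivStep α)) (x : List α) (hL : P.IsDerivation x L y),
      comp (addTrivial (Quot.mk _ ⟨L, hL⟩ : P.Diagram x y) x')
        (trivialAdd y (Quot.mk _ ⟨M, hM⟩ : P.Diagram x' y')) =
      comp (trivialAdd x (Quot.mk _ ⟨M, hM⟩ : P.Diagram x' y'))
        (addTrivial (Quot.mk _ ⟨L, hL⟩ : P.Diagram x y) y') from H M x' hM y L x hL
  clear hL hM L M x x' y
  intro M
  induction M with
  | nil =>
    intro x' hM y L x hL
    cases hM
    exact congrArg (Quot.mk _) (Subtype.ext (by simp))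
  | cons f M ihM =>
    intro x' hM y L
    have hM' := hM
    obtain ⟨f1, rfl, f3⟩ := hM'
    induction L with
    | nil =>
      intro x hL
      cases hL
      exact congrArg (Quot.mk _) (Subtype.ext (by simp))
    | cons e L ihL =>
      intro x hL
      have hL' := hL
      obtain ⟨e1, rfl, e3⟩ := hL'
      let E : P.Diagram (e.left ++ e.top ++ e.right) (e.left ++ e.bot ++ e.right) := Quot.mk _ ⟨[e], e1, rfl, rfl⟩
      let F : P.Diagram (f.left ++ f.top ++ f.right) (f.left ++ f.bot ++ f.right) := Quot.mk _ ⟨[f], f1, rfl, rfl⟩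
      let A : P.Diagram (e.left ++ e.bot ++ e.right) y := Quot.mk _ ⟨L, e3⟩
      let B : P.Diagram (f.left ++ f.bot ++ f.right) y' := Quot.mk _ ⟨M, f3⟩
      have hA : (Quot.mk _ ⟨e :: L, hL⟩ : P.Diagram (e.left ++ e.top ++ e.right) y) =
          E.comp A := rfl
      have hB : (Quot.mk _ ⟨f :: M, hM⟩ : P.Diagram (f.left ++ f.top ++ f.right) y') =
          F.comp B := rfl
      have hEF : (E.addTrivial _).comp (trivialAdd _ F) =
          (trivialAdd _ F).comp (E.addTrivial _) := by
        apply Quot.sound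
        have := Exchange.mk [] [] e.left e.top e.bot (e.right ++ f.left) f.top f.bot f.right
        simpa [DerivStep.addRight, DerivStep.addLeft] using this
      have i1 : (A.addTrivial _).comp (trivialAdd y (F.comp B)) =
          (trivialAdd (e.left ++ e.bot ++ e.right) (F.comp B)).comp (A.addTrivial y') := ihL (e.left ++ e.bot ++ e.right) e3
      have i2 : (E.addTrivial (f.left ++ f.bot ++ f.right)).comp (trivialAdd (e.left ++ e.bot ++ e.right) B) =
          (trivialAdd _ B).comp (E.addTrivial y') := ihM (f.left ++ f.bot ++ f.right) f3 _ [e] _ ⟨e1, rfl, rfl⟩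
      rw [hA, hB, comp_addTrivial, comp_assoc, i1, trivialAdd_comp, comp_assoc, ← comp_assoc _ _
        (comp _ _), hEF, comp_assoc, ← comp_assoc (E.addTrivial (f.left ++ f.bot ++ f.right)), i2, trivialAdd_comp,
        comp_addTrivial]
      simp only [comp_assoc]

theorem sum_comp_sum {x y z x' y' z' : List α} (A : P.Diagram x y) (B : P.Diagram y z)
    (A' : P.Diagram x' y') (B' : P.Diagram y' z') :
    (A.sum A').comp (B.sum B') = (A.comp B).sum (A'.comp B') := by
  unfold sum
  rw [comp_addTrivial, trivialAdd_comp, comp_assoc, comp_assoc, ← comp_assoc (trivialAdd y A'),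
    ← addTrivial_comp_trivialAdd, comp_assoc]

/-- `D` is a prefix of `E`. -/
def IsPrefix {x y z : List α} (D : P.Diagram x y) (E : P.Diagram x z) : Prop :=
  ∃ F : P.Diagram y z, E = D.comp F

/-- `F` is a suffix of `E`. -/
def IsSuffix {x y z : List α} (F : P.Diagram y z) (E : P.Diagram x z) : Prop :=
  ∃ D : P.Diagram x y, E = D.comp F

/-- Thin diagrams: sums of atomic diagrams (an atomic diagram has exactly one cell).  A trivial
diagram counts as a thin diagram without cells. -/
inductive IsThin : ∀ {x y : List α}, P.Diagram x y → Prop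
  | trivial (x : List α) : IsThin (Diagram.trivial P x)
  | atomic {x y : List α} (A : P.Diagram x y) : A.numCells = 1 → IsThin A
  | sum {x y x' y' : List α} (A : P.Diagram x y) (B : P.Diagram x' y') :
      IsThin A → IsThin B → IsThin (A.sum B)

/-- `F` is the maximal thin suffix of `D`. -/
def IsMaximalThinSuffix {x y z : List α} (F : P.Diagram y z) (D : P.Diagram x z) : Prop :=
  F.IsThin ∧ F.IsSuffix D ∧
    ∀ (y' : List α) (F' : P.Diagram y' z), F'.IsThin → F'.IsSuffix D → F'.IsSuffix F

/-- A diagram is minimal if its maximal thin suffix has exactly one cell. -/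
def IsMinimal {x z : List α} (D : P.Diagram x z) : Prop :=
  ∃ (y : List α) (F : P.Diagram y z), F.IsMaximalThinSuffix D ∧ F.numCells = 1

/-- `E` is obtained from `D` by reducing a dipole, i.e. by removing a cell and a mirror image of
it that lies just below. -/
def ReducesDipole {x y : List α} (D E : P.Diagram x y) : Prop :=
  ∃ (z t : List α) (D₁ : P.Diagram x z) (A : P.Diagram z t) (D₂ : P.Diagram z y),
    A.numCells = 1 ∧ D = (D₁.comp (A.comp A.mirror)).comp D₂ ∧ E = D₁.comp D₂

/-- A diagram is reduced if it has no dipoles. -/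
def IsReduced {x y : List α} (D : P.Diagram x y) : Prop :=
  ¬ ∃ E : P.Diagram x y, D.ReducesDipole E

end Diagram

/-- `(x, y)`-diagrams modulo reduction of dipoles.  Every class holds exactly one reduced diagram,
so the classes stand for the reduced `(x, y)`-diagrams, and the product of classes induced by
concatenation is the reduced form of the concatenation. -/
def DiagramClass (x y : List α) : Type _ :=
  Quot fun D E : P.Diagram x y => D.ReducesDipole E

variable {P}

/-- The class of a diagram modulo reduction of dipoles. -/
def Diagram.toClass {x y : List α} (D : P.Diagram x y) : P.DiagramClass x y := Quot.mk _ D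

namespace DiagramClass

open Diagram

/-- The product of reduced diagrams: the reduced form of the concatenation. -/
def comp {x y z : List α} (g : P.DiagramClass x y) (h : P.DiagramClass y z) :
    P.DiagramClass x z :=
  Quot.map₂ Diagram.comp
    (by
      rintro D _ _ ⟨z, t, D₁, A, D₂, hA, rfl, rfl⟩
      exact ⟨z, t, D.comp D₁, A, D₂, hA, by simp only [comp_assoc], by simp only [comp_assoc]⟩)
    (by
      rintro _ _ D ⟨z, t, D₁, A, D₂, hA, rfl, rfl⟩
      exact ⟨z, t, D₁, A, D₂.comp D, hA, by simp only [comp_assoc], by simp only [comp_assoc]⟩)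
    g h

/-- The inverse, given by the mirror image. -/
def inv {x y : List α} (g : P.DiagramClass x y) : P.DiagramClass y x :=
  Quot.map Diagram.mirror
    (by
      rintro _ _ ⟨z, t, D₁, A, D₂, hA, rfl, rfl⟩
      exact ⟨z, t, D₂.mirror, A, D₁.mirror, hA,
        by simp only [mirror_comp, mirror_mirror, comp_assoc], by simp only [mirror_comp]⟩) g

/-- The sum of diagrams, modulo reduction of dipoles. -/
def sum {x y x' y' : List α} (g : P.DiagramClass x y) (h : P.DiagramClass x' y') :
    P.DiagramClass (x ++ x') (y ++ y') :=
  Quot.map₂ Diagram.sum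
    (by
      rintro D _ _ ⟨z, t, D₁, A, D₂, hA, rfl, rfl⟩
      refine ⟨_, _, (D.addTrivial _).comp (trivialAdd y D₁), trivialAdd y A, trivialAdd y D₂,
        by rw [numCells_trivialAdd, hA], ?_, ?_⟩ <;>
      simp only [Diagram.sum, trivialAdd_comp, mirror_trivialAdd, comp_assoc])
    (by
      rintro _ _ D ⟨z, t, D₁, A, D₂, hA, rfl, rfl⟩
      refine ⟨_, _, D₁.addTrivial _, A.addTrivial _, (D₂.addTrivial _).comp (trivialAdd _ D),
        by rw [numCells_addTrivial, hA], ?_, ?_⟩ <;>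
      simp only [Diagram.sum, comp_addTrivial, mirror_addTrivial, comp_assoc])
    g h

theorem comp_assoc {x y z t : List α} (g : P.DiagramClass x y) (h : P.DiagramClass y z)
    (k : P.DiagramClass z t) : (g.comp h).comp k = g.comp (h.comp k) := by
  induction g using Quot.ind
  induction h using Quot.ind
  induction k using Quot.ind
  exact congrArg (Quot.mk _) (Diagram.comp_assoc _ _ _)

theorem trivial_comp {x y : List α} (g : P.DiagramClass x y) :
    (trivial P x).toClass.comp g = g := by
  induction g using Quot.ind
  exact congrArg (Quot.mk _) (Diagram.trivial_comp _)

theorem comp_trivial {x y : List α} (g : P.DiagramClass x y) :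
    g.comp (trivial P y).toClass = g := by
  induction g using Quot.ind
  exact congrArg (Quot.mk _) (Diagram.comp_trivial _)

theorem inv_inv {x y : List α} (g : P.DiagramClass x y) : g.inv.inv = g := by
  induction g using Quot.ind
  exact congrArg (Quot.mk _) (Diagram.mirror_mirror _)

theorem comp_inv {x y : List α} (g : P.DiagramClass x y) :
    g.comp g.inv = (trivial P x).toClass := by
  induction g using Quot.ind with
  | mk D =>
  induction D using Quot.ind with
  | mk L =>
  obtain ⟨L, hL⟩ := L
  induction L generalizing x with
  | nil => cases hL; rfl
  | cons e L ih =>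
    have hL' := hL
    obtain ⟨e1, rfl, e3⟩ := hL'
    let E : P.Diagram (e.left ++ e.top ++ e.right) (e.left ++ e.bot ++ e.right) :=
      Quot.mk _ ⟨[e], e1, rfl, rfl⟩
    let A : P.Diagram (e.left ++ e.bot ++ e.right) y := Quot.mk _ ⟨L, e3⟩
    have hE : E.toClass.comp E.toClass.inv = (trivial P _).toClass := by
      apply Quot.sound
      refine ⟨_, _, trivial P _, E, trivial P _, rfl, ?_, ?_⟩
      · rw [Diagram.trivial_comp, Diagram.comp_trivial]
      · rw [Diagram.trivial_comp]
    have h1 : (Quot.mk _ (Quot.mk _ ⟨e :: L, hL⟩) : P.DiagramClass _ y) =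
        E.toClass.comp A.toClass := rfl
    have h2 : (E.toClass.comp A.toClass).inv = A.toClass.inv.comp E.toClass.inv :=
      congrArg (Quot.mk _) (mirror_comp E A)
    have hA : A.toClass.comp A.toClass.inv = (trivial P _).toClass := ih e3
    rw [h1, h2, comp_assoc, ← comp_assoc A.toClass, hA, trivial_comp, hE]

theorem inv_comp {x y : List α} (g : P.DiagramClass x y) :
    g.inv.comp g = (trivial P y).toClass := by
  have := comp_inv g.inv
  rwa [inv_inv] at this

theorem sum_comp_sum {x y z x' y' z' : List α} (g : P.DiagramClass x y) (h : P.DiagramClass y z)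
    (g' : P.DiagramClass x' y') (h' : P.DiagramClass y' z') :
    (g.sum g').comp (h.sum h') = (g.comp h).sum (g'.comp h') := by
  induction g using Quot.ind
  induction h using Quot.ind
  induction g' using Quot.ind
  induction h' using Quot.ind
  exact congrArg (Quot.mk _) (Diagram.sum_comp_sum _ _ _ _)

end DiagramClass

variable (P)

/-- The diagram group `D(P, w)`: `(w, w)`-diagrams modulo reduction of dipoles. -/
abbrev DiagramGroup (w : List α) : Type _ := P.DiagramClass w w

instance DiagramGroup.instGroup (w : List α) : Group (P.DiagramGroup w) where
  mul g h := DiagramClass.comp g h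
  one := (Diagram.trivial P w).toClass
  inv g := DiagramClass.inv g
  mul_assoc := DiagramClass.comp_assoc
  one_mul := DiagramClass.trivial_comp
  mul_one := DiagramClass.comp_trivial
  inv_mul_cancel := DiagramClass.inv_comp

/-- The homomorphism `D(P, a) × D(P, b) → D(P, aub)`, `(A, B) ↦ A + ε(u) + B`. -/
def canonicalHom (a u b : List α) :
    P.DiagramGroup a × P.DiagramGroup b →* P.DiagramGroup (a ++ u ++ b) where
  toFun g := DiagramClass.sum (DiagramClass.sum g.1 (Diagram.trivial P u).toClass) g.2
  map_one' := rfl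
  map_mul' g h := by
    change DiagramClass.sum (DiagramClass.sum (DiagramClass.comp g.1 h.1) _)
      (DiagramClass.comp g.2 h.2) = DiagramClass.comp _ _
    rw [DiagramClass.sum_comp_sum, DiagramClass.sum_comp_sum, DiagramClass.trivial_comp]

variable {P}

/-- The homomorphism `D(P, z) → D(P, w)`, `g ↦ D · g · D⁻¹`, for a `(w, z)`-diagram `D`. -/
def conjHom {w z : List α} (D : P.Diagram w z) : P.DiagramGroup z →* P.DiagramGroup w where
  toFun g := DiagramClass.comp (DiagramClass.comp D.toClass g) D.toClass.inv
  map_one' := by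
    change DiagramClass.comp (DiagramClass.comp _ (Diagram.trivial P z).toClass) _ =
      (Diagram.trivial P w).toClass
    rw [DiagramClass.comp_trivial, DiagramClass.comp_inv]
  map_mul' g h := by
    change DiagramClass.comp (DiagramClass.comp _ (DiagramClass.comp g h)) _ =
      DiagramClass.comp (DiagramClass.comp (DiagramClass.comp _ g) _)
        (DiagramClass.comp (DiagramClass.comp _ h) _)
    simp only [DiagramClass.comp_assoc]
    rw [← DiagramClass.comp_assoc D.toClass.inv, DiagramClass.inv_comp, DiagramClass.trivial_comp]

variable (P)

/-- The vertices of the Farley complex `X(P, w)`: reduced diagrams with top label `w` (as classes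
modulo reduction of dipoles); the first component is the bottom label. -/
def FarleyVertex (w : List α) : Type _ := Σ y : List α, P.DiagramClass w y

variable {P}

/-- The vertex given by the reduced form of `D`. -/
def Diagram.toVertex {w y : List α} (D : P.Diagram w y) : P.FarleyVertex w := ⟨y, D.toClass⟩

/-- The action of the diagram group on the vertices by left multiplication. -/
instance FarleyVertex.instMulAction (w : List α) :
    MulAction (P.DiagramGroup w) (P.FarleyVertex w) where
  smul g V := ⟨V.1, DiagramClass.comp g V.2⟩
  one_smul V := Sigma.ext rfl (heq_of_eq (DiagramClass.trivial_comp V.2))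
  mul_smul g h V := Sigma.ext rfl (heq_of_eq (DiagramClass.comp_assoc g h V.2))

variable (P)

/-- The 1-skeleton of the Farley complex: `V` and `W` span an edge if `W = V · A` for some atomic
diagram `A`. -/
def farleyGraph (w : List α) : SimpleGraph (P.FarleyVertex w) where
  Adj V W := ∃ A : P.Diagram V.1 W.1, A.numCells = 1 ∧ W.2 = V.2.comp A.toClass
  symm := ⟨by
    rintro V W ⟨A, hA, h⟩
    refine ⟨A.mirror, by rw [Diagram.numCells_mirror, hA], ?_⟩
    have : A.mirror.toClass = A.toClass.inv := rfl
    rw [h, this, DiagramClass.comp_assoc, DiagramClass.comp_inv, DiagramClass.comp_trivial]⟩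
  loopless := ⟨by
    rintro V ⟨A, hA, -⟩
    exact A.ne_of_numCells_eq_one hA rfl⟩

variable {P}

/-- `e` and `f` are parallel sides of a square of the Farley complex.  The squares are spanned by
`{V · Q | Q ≤ Γ}` with `Γ` thin with two cells; so `Γ = A + B` for atomic diagrams `A` and `B`, the
vertices are `V`, `V · (A + ε)`, `V · (ε + B)` and `V · (A + B)`, and the two pairs of opposite
sides are those listed. -/
inductive Parallel (w : List α) : Sym2 (P.FarleyVertex w) → Sym2 (P.FarleyVertex w) → Prop
  | left {x y x' y' : List α} (V : P.DiagramClass w (x ++ x')) (A : P.Diagram x y)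
      (B : P.Diagram x' y') (hA : A.numCells = 1) (hB : B.numCells = 1) :
      Parallel w
        s((⟨_, V⟩ : P.FarleyVertex w), ⟨_, V.comp (A.sum (.trivial P x')).toClass⟩)
        s((⟨_, V.comp ((Diagram.trivial P x).sum B).toClass⟩ : P.FarleyVertex w),
          ⟨_, V.comp (A.sum B).toClass⟩)
  | right {x y x' y' : List α} (V : P.DiagramClass w (x ++ x')) (A : P.Diagram x y)
      (B : P.Diagram x' y') (hA : A.numCells = 1) (hB : B.numCells = 1) :
      Parallel w
        s((⟨_, V⟩ : P.FarleyVertex w), ⟨_, V.comp ((Diagram.trivial P x).sum B).toClass⟩)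
        s((⟨_, V.comp (A.sum (.trivial P x')).toClass⟩ : P.FarleyVertex w),
          ⟨_, V.comp (A.sum B).toClass⟩)

/-- A hyperplane of the Farley complex: a class of edges for the equivalence relation generated by
being parallel sides of a square. -/
def IsHyperplane {w : List α} (J : Set (Sym2 (P.FarleyVertex w))) : Prop :=
  ∃ e ∈ (P.farleyGraph w).edgeSet, J = {f | Relation.EqvGen (Parallel w) e f}

/-- `H` is (the vertex set of) a halfspace of `J`: a connected component of the complex after
cutting along `J`. -/
def IsHalfspace {w : List α} (J : Set (Sym2 (P.FarleyVertex w))) (H : Set (P.FarleyVertex w)) :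
    Prop :=
  ∃ C : ((P.farleyGraph w).deleteEdges J).ConnectedComponent, H = C.supp

/-- `H` is the halfspace `J⁺` of `J` that does not contain `ε(w)`. -/
def IsPositiveHalfspace {w : List α} (J : Set (Sym2 (P.FarleyVertex w)))
    (H : Set (P.FarleyVertex w)) : Prop :=
  IsHalfspace J H ∧ (Diagram.trivial P w).toVertex ∉ H

/-- The vertices `E` of the Farley complex with `D ≤ E`, as reduced diagrams. -/
def Diagram.upperSet {w z : List α} (D : P.Diagram w z) : Set (P.FarleyVertex w) :=
  {V | ∃ E : P.Diagram w V.1, E.IsReduced ∧ E.toClass = V.2 ∧ D.IsPrefix E}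

/-- `D` is the minimal diagram associated with `J`: the minimal reduced diagram with
`J⁺ = {E | D ≤ E}`. -/
def IsMinimalDiagramOf {w z : List α} (J : Set (Sym2 (P.FarleyVertex w))) (D : P.Diagram w z) :
    Prop :=
  D.IsReduced ∧ D.IsMinimal ∧ IsPositiveHalfspace J D.upperSet

/-- The stabilizer of a set of edges in the diagram group. -/
def hyperplaneStabilizer {w : List α} (J : Set (Sym2 (P.FarleyVertex w))) :
    Subgroup (P.DiagramGroup w) where
  carrier := {g | Sym2.map (fun V => g • V) '' J = J}
  one_mem' := by simp
  mul_mem' := by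
    intro g h hg hh
    have : Sym2.map (fun V : P.FarleyVertex w => (g * h) • V) =
        Sym2.map (fun V => g • V) ∘ Sym2.map (fun V => h • V) := by
      rw [← Sym2.map_comp]
      simp [Function.comp_def, mul_smul]
    simp only [Set.mem_ofPred_eq] at *
    rw [this, Set.image_comp, hh, hg]
  inv_mem' := by
    intro g hg
    simp only [Set.mem_ofPred_eq] at *
    conv_lhs => rw [← hg]
    rw [← Set.image_comp, ← Sym2.map_comp]
    simp

end SemigroupPresentation

namespace SemigroupPresentation

open DerivStep

universe u

/-! Let `e` be the edge `[Δbar, Δbar · F]`. It lies in `J`: otherwise `Δbar` would be in the same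
component of the cut complex as `Δ`, so `Δ` would be a prefix of the reduced diagram `Δbar`, which
has fewer cells (`edge_mem_of_isPositiveHalfspace`). So `J` is the parallelism class of `e`. In a
square that contains an edge labelled by a `(u, v)`-cell between `a'` and `b'`, the other cell acts
on a subword disjoint from `u`, hence inside `a'` or inside `b'`. By induction every edge of `J` has
the form `[Δbar · (A + ε(u) + B), Δbar · (A + Π + B)]` (`Parallel.mem_translateEdges`). If `g`
stabilizes `J`, then `g • e` has this form. Left multiplication keeps the cell of an edge and its
position, and an oriented edge determines both (`Steps.step_unique`). As `u ≠ v` the orientations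
agree, so `A` is an `(a, a)`-diagram, `B` is a `(b, b)`-diagram and `g · Δbar = Δbar · (A + ε(u) +
B)`. Conversely, drawing `A` and then `B` cell by cell carries `e` through a chain of squares to its
translate. Both `Steps.step_unique` and the injectivity of the canonical homomorphism need a reduced
diagram to be determined by its class. This is shown by an action on normal forms: a diagram acts on
words whose letters store the cells that produced them, and a cell glued below the whole bottom of
its mirror image restores the earlier word. The action is invariant under isotopy and dipole
reduction. Along a reduced derivation nothing ever cancels, so the final word records the diagram,
and the cells can be read off from the bottom up (`IsReducedDerivation.isotopic_of_run_eq`). -/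

/-! ### Tracked letters and the action of a single cell. -/

/-- Letters that remember how they were produced: `base s` is a letter of the initial word, and
`out M v j c` is the `j`-th letter `c` of the bottom label `v` of a cell glued below the tracked
word `M`. -/
inductive TrackedLetter (α : Type u) : Type u
  | base (s : α) : TrackedLetter α
  | out (M : List (TrackedLetter α)) (v : List α) (j : ℕ) (c : α) : TrackedLetter α

namespace TrackedLetter

variable {α : Type u}

/-- The underlying letter. -/
def label : TrackedLetter α → α
  | base s => s
  | out _ _ _ c => c

/-- The tracked bottom word of a cell with bottom label `v` glued below `M`. -/
def outs (M : List (TrackedLetter α)) (v : List α) : List (TrackedLetter α) :=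
  v.mapIdx fun j c => out M v j c

@[simp] theorem length_outs (M : List (TrackedLetter α)) (v : List α) :
    (outs M v).length = v.length := by simp [outs]

@[simp] theorem map_label_outs (M : List (TrackedLetter α)) (v : List α) :
    (outs M v).map label = v := by
  apply List.ext_getElem <;> simp [outs, label]

@[simp] theorem map_label_base (x : List α) : (x.map base).map label = x := by
  simp [Function.comp_def, label]

theorem mem_outs {M : List (TrackedLetter α)} {v : List α} {t : TrackedLetter α}
    (h : t ∈ outs M v) : ∃ j c, t = out M v j c := by
  obtain ⟨j, hj, rfl⟩ := List.mem_mapIdx.1 h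
  exact ⟨_, _, rfl⟩

theorem exists_mem_outs (M : List (TrackedLetter α)) {v : List α} (hv : v ≠ []) :
    ∃ j c, out M v j c ∈ outs M v := by
  cases v with
  | nil => exact absurd rfl hv
  | cons c v => exact ⟨0, c, by simp [outs]⟩

theorem getElem?_outs {M : List (TrackedLetter α)} {v : List α} {i : ℕ} (h : i < v.length) :
    (outs M v)[i]? = some (out M v i v[i]) := by
  simp [outs, h]

/-- Each letter of an output stores both words, so one letter is enough; an empty output would
remember nothing. -/
theorem outs_injective {M N : List (TrackedLetter α)} {v v' : List α} (hv : v ≠ [])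
    (h : outs M v = outs N v') : M = N ∧ v = v' := by
  obtain ⟨j, c, hc⟩ := exists_mem_outs M hv
  rw [h] at hc
  obtain ⟨j', c', h'⟩ := mem_outs hc
  cases h'
  exact ⟨rfl, rfl⟩

/-- `T` is the full bottom word of a cell with top word `M` whose top label is `v`. -/
def IsOutput (v : List α) (T M : List (TrackedLetter α)) : Prop :=
  M.map label = v ∧ T = outs M (T.map label)

open Classical in
/-- Gluing a cell with bottom label `v` below the tracked word `T`, with cancellation. -/
noncomputable def cellMap (v : List α) (T : List (TrackedLetter α)) : List (TrackedLetter α) :=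
  if h : ∃ M, IsOutput v T M then h.choose else outs T v

/-- Tracked letters without cancelling cells in their history. -/
inductive Good : TrackedLetter α → Prop
  | base (s : α) : Good (base s)
  | out (M : List (TrackedLetter α)) (v : List α) (j : ℕ) (c : α) (hM : ∀ m ∈ M, Good m)
      (h : ¬ ∃ N, IsOutput v M N) : Good (out M v j c)

theorem cellMap_eq_outs {v : List α} {T : List (TrackedLetter α)} (h : ¬ ∃ M, IsOutput v T M) :
    cellMap v T = outs T v := dif_neg h

theorem cellMap_outs {u : List α} (hu : u ≠ []) (M : List (TrackedLetter α)) :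
    cellMap (M.map label) (outs M u) = M := by
  have h : ∃ N, IsOutput (M.map label) (outs M u) N := ⟨M, rfl, by simp⟩
  rw [cellMap, dif_pos h]
  exact ((outs_injective hu h.choose_spec.2).1).symm

@[simp] theorem map_label_cellMap (v : List α) (T : List (TrackedLetter α)) :
    (cellMap v T).map label = v := by
  unfold cellMap
  split_ifs with h
  · exact h.choose_spec.1
  · simp

/-- When the cell cancels, the restored word is part of the history of a good letter, hence good;
when it does not, its output is good because nothing was there to cancel. -/
theorem good_cellMap {v : List α} {T : List (TrackedLetter α)} (hT : T ≠ [])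
    (h : ∀ t ∈ T, Good t) : ∀ t ∈ cellMap v T, Good t := by
  by_cases hc : ∃ M, IsOutput v T M
  · obtain ⟨M, rfl, hM⟩ := hc
    have hu : T.map label ≠ [] := by simpa using hT
    obtain ⟨j, c, hj⟩ := exists_mem_outs M hu
    rw [← hM] at hj
    have := h _ hj
    rw [hM, cellMap_outs hu]
    cases this with
    | out _ _ _ _ hM _ => exact hM
  · rw [cellMap_eq_outs hc]
    intro t ht
    obtain ⟨j, c, rfl⟩ := mem_outs ht
    exact Good.out _ _ _ _ h hc

/-- This is where goodness matters: if the first cell cancels `T` back to `M`, goodness of `T` says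
that the second cell cannot cancel against `M` in turn, so it creates `T` again. If the first cell
does not cancel, the second one undoes its fresh output. -/
theorem cellMap_cellMap {v : List α} {T : List (TrackedLetter α)} (hv : v ≠ []) (hT : T ≠ [])
    (h : ∀ t ∈ T, Good t) : cellMap (T.map label) (cellMap v T) = T := by
  by_cases hc : ∃ M, IsOutput v T M
  · obtain ⟨M, rfl, hM⟩ := hc
    have hu : T.map label ≠ [] := by simpa using hT
    generalize T.map label = u at *
    subst hM
    rw [cellMap_outs hu]
    obtain ⟨j, c, hj⟩ := exists_mem_outs M hu
    have := h _ hj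
    cases this with
    | out _ _ _ _ _ hM => exact cellMap_eq_outs hM
  · rw [cellMap_eq_outs hc, cellMap_outs hv]

/-- Two full outputs inside a word are equal or disjoint. -/
theorem outs_overlap {A N B C M D : List (TrackedLetter α)} {v v' : List α} (hv : v ≠ [])
    (hv' : v' ≠ []) (h : A ++ outs N v ++ B = C ++ outs M v' ++ D) :
    (A = C ∧ N = M ∧ v = v' ∧ B = D) ∨
      (∃ K, C = A ++ outs N v ++ K ∧ B = K ++ outs M v' ++ D) ∨
      ∃ K, A = C ++ outs M v' ++ K ∧ D = K ++ outs N v ++ B := by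
  have h1 := List.length_pos_of_ne_nil hv
  have h2 := List.length_pos_of_ne_nil hv'
  rcases le_or_gt (A.length + v.length) C.length with h3 | h3
  · right; left
    rw [List.append_assoc C] at h
    rcases List.append_eq_append_iff.1 h with ⟨K, hK, hK'⟩ | ⟨K, hK, hK'⟩
    · exact ⟨K, hK, by simpa using hK'⟩
    · have := congrArg List.length hK
      simp at this
      have : K = [] := List.length_eq_zero_iff.1 (by omega)
      subst this
      exact ⟨[], by simpa using hK.symm, by simpa using hK'.symm⟩
  rcases le_or_gt (C.length + v'.length) A.length with h4 | h4
  · right; right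
    rw [List.append_assoc A] at h
    rcases List.append_eq_append_iff.1 h with ⟨K, hK, hK'⟩ | ⟨K, hK, hK'⟩
    · have := congrArg List.length hK
      simp at this
      have : K = [] := List.length_eq_zero_iff.1 (by omega)
      subst this
      exact ⟨[], by simpa using hK.symm, by simpa using hK'.symm⟩
    · exact ⟨K, hK, by simpa using hK'⟩
  left
  -- A common letter stores the history, the bottom label and its index `j` in the block; the index
  -- forces both blocks to start at the same place.
  have key : ∀ i, A.length ≤ i → C.length ≤ i → i < A.length + v.length →
      i < C.length + v'.length → N = M ∧ v = v' ∧ A.length = C.length := by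
    intro i hi hi' hi1 hi2
    have := congrArg (fun l => l[i]?) h
    rw [List.getElem?_append_left (by simpa using hi1), List.getElem?_append_right hi,
      List.getElem?_append_left (by simpa using hi2), List.getElem?_append_right hi',
      getElem?_outs (by omega), getElem?_outs (by omega)] at this
    simp only [Option.some.injEq, out.injEq] at this
    refine ⟨this.1, this.2.1, by omega⟩
  obtain ⟨rfl, rfl, h5⟩ := key (max A.length C.length) (by omega) (by omega) (by omega) (by omega)
  rw [List.append_assoc, List.append_assoc] at h
  obtain ⟨rfl, h6⟩ := List.append_inj h h5
  exact ⟨rfl, rfl, rfl, List.append_cancel_left h6⟩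

/-! ### Derivations acting on tracked words. -/

/-- The action of a derivation step on tracked words. -/
noncomputable def applyStep (T : List (TrackedLetter α)) (e : DerivStep α) :
    List (TrackedLetter α) :=
  T.take e.left.length ++ cellMap e.bot ((T.drop e.left.length).take e.top.length) ++
    T.drop (e.left.length + e.top.length)

theorem applyStep_append {e : DerivStep α} {A B : List (TrackedLetter α)}
    (hA : A.map label = e.left) (hB : B.map label = e.top) (C : List (TrackedLetter α)) :
    applyStep (A ++ B ++ C) e = A ++ cellMap e.bot B ++ C := by
  simp only [applyStep, ← hA, ← hB, List.length_map]
  simp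

theorem exists_split {T : List (TrackedLetter α)} {p u q : List α}
    (h : T.map label = p ++ u ++ q) :
    ∃ A B C, T = A ++ B ++ C ∧ A.map label = p ∧ B.map label = u ∧ C.map label = q := by
  obtain ⟨T', C, rfl, h1, hC⟩ := List.map_eq_append_iff.1 h
  obtain ⟨A, B, rfl, hA, hB⟩ := List.map_eq_append_iff.1 h1
  exact ⟨A, B, C, rfl, hA, hB, hC⟩

/-- The action of a derivation on tracked words. -/
noncomputable def run (T : List (TrackedLetter α)) (L : List (DerivStep α)) :
    List (TrackedLetter α) := L.foldl applyStep T

@[simp] theorem run_nil (T : List (TrackedLetter α)) : run T [] = T := rfl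

@[simp] theorem run_cons (T : List (TrackedLetter α)) (e : DerivStep α) (L : List (DerivStep α)) :
    run T (e :: L) = run (applyStep T e) L := rfl

@[simp] theorem run_append (T : List (TrackedLetter α)) (L M : List (DerivStep α)) :
    run T (L ++ M) = run (run T L) M := List.foldl_append

end TrackedLetter

open TrackedLetter

variable {α : Type u} {P : SemigroupPresentation α}

theorem IsCell.ne_nil {u v : List α} (h : P.IsCell u v) : u ≠ [] ∧ v ≠ [] := by
  rcases h with h | h
  · exact P.ne_nil h
  · exact (P.ne_nil h).symm

theorem isDerivation_append {x z : List α} {L M : List (DerivStep α)} :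
    P.IsDerivation x (L ++ M) z ↔ ∃ y, P.IsDerivation x L y ∧ P.IsDerivation y M z := by
  refine ⟨fun h => ?_, fun ⟨y, h, h'⟩ => h.append h'⟩
  induction L generalizing x with
  | nil => exact ⟨x, rfl, h⟩
  | cons e L ih =>
    obtain ⟨y, h1, h2⟩ := ih h.2.2
    exact ⟨y, ⟨h.1, h.2.1, h1⟩, h2⟩

theorem isDerivation_singleton {x y : List α} {e : DerivStep α} :
    P.IsDerivation x [e] y ↔ P.IsCell e.top e.bot ∧ x = e.left ++ e.top ++ e.right ∧
      y = e.left ++ e.bot ++ e.right := by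
  simp [IsDerivation, eq_comm]

theorem IsDerivation.map_label_run {x y : List α} {L : List (DerivStep α)}
    (h : P.IsDerivation x L y) {T : List (TrackedLetter α)} (hT : T.map label = x) :
    (run T L).map label = y := by
  induction L generalizing x T with
  | nil => exact hT.trans h
  | cons e L ih =>
    obtain ⟨-, rfl, h3⟩ := h
    obtain ⟨A, B, C, rfl, hA, hB, hC⟩ := exists_split hT
    rw [run_cons, applyStep_append hA hB]
    exact ih h3 (by simp [hA, hC])

theorem IsDerivation.good_run {x y : List α} {L : List (DerivStep α)}
    (h : P.IsDerivation x L y) {T : List (TrackedLetter α)} (hT : T.map label = x)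
    (hg : ∀ t ∈ T, Good t) : ∀ t ∈ run T L, Good t := by
  induction L generalizing x T with
  | nil => exact hg
  | cons e L ih =>
    obtain ⟨h1, rfl, h3⟩ := h
    obtain ⟨A, B, C, rfl, hA, hB, hC⟩ := exists_split hT
    have hB' : B ≠ [] := by
      rintro rfl
      exact h1.ne_nil.1 hB.symm
    rw [run_cons, applyStep_append hA hB]
    refine ih h3 (by simp [hA, hC]) ?_
    have := good_cellMap (v := e.bot) hB' fun t ht => hg t (by simp [ht])
    intro t ht
    rcases List.mem_append.1 ht with ht | ht
    · rcases List.mem_append.1 ht with ht | ht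
      · exact hg t (by simp [ht])
      · exact this t ht
    · exact hg t (by simp [ht])

/-! ### Invariance under isotopy. -/

theorem Exchange.isDerivation_iff {L M : List (DerivStep α)} (h : Exchange L M) {x y : List α} :
    P.IsDerivation x L y ↔ P.IsDerivation x M y := by
  cases h with
  | mk L M p u v q u' v' r =>
    rw [isDerivation_append, isDerivation_append]
    refine exists_congr fun z => and_congr_right fun _ => ?_
    simp only [IsDerivation, List.append_assoc, true_and]
    tauto

/-- The two steps rewrite separate blocks of the tracked word, and the new block depends only on the
block it replaces. -/
theorem Exchange.run_eq {L M : List (DerivStep α)} (h : Exchange L M) {x y : List α}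
    (hL : P.IsDerivation x L y) {T : List (TrackedLetter α)} (hT : T.map label = x) :
    run T L = run T M := by
  cases h with
  | mk L M p u v q u' v' r =>
    obtain ⟨z, h1, h2⟩ := isDerivation_append.1 hL
    have h3 := h1.map_label_run hT
    rw [h2.2.1] at h3
    obtain ⟨A, B, S, hS, rfl, rfl, h4⟩ := exists_split h3
    obtain ⟨C, D, E, rfl, rfl, rfl, rfl⟩ := exists_split h4
    rw [run_append, run_append]
    generalize run T L = T' at *
    subst hS
    simp only [run_cons]
    congr 1
    have e1 : applyStep (A ++ B ++ (C ++ D ++ E)) ⟨A.map label, B.map label, v,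
        C.map label ++ D.map label ++ E.map label⟩ = _ := applyStep_append rfl rfl _
    rw [e1]
    have e2 : applyStep (A ++ cellMap v B ++ C ++ D ++ E) ⟨A.map label ++ v ++ C.map label,
        D.map label, v', E.map label⟩ = _ := applyStep_append (by simp) rfl _
    have e3 : applyStep (A ++ B ++ C ++ D ++ E) ⟨A.map label ++ B.map label ++ C.map label,
        D.map label, v', E.map label⟩ = _ := applyStep_append (by simp) rfl _
    have e4 : applyStep (A ++ B ++ (C ++ cellMap v' D ++ E)) ⟨A.map label, B.map label, v,
        C.map label ++ v' ++ E.map label⟩ = _ := applyStep_append rfl rfl _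
    simp only [List.append_assoc] at *
    rw [e2, e3, e4]

/-- Isotopy of derivations. -/
abbrev Isotopic (L M : List (DerivStep α)) : Prop := Relation.EqvGen Exchange L M

theorem Isotopic.isDerivation_iff {L M : List (DerivStep α)} (h : Isotopic L M) {x y : List α} :
    P.IsDerivation x L y ↔ P.IsDerivation x M y := by
  induction h with
  | rel _ _ h => exact Exchange.isDerivation_iff h
  | refl => rfl
  | symm _ _ _ ih => exact ih.symm
  | trans _ _ _ _ _ ih ih' => exact ih.trans ih'

theorem Isotopic.run_eq {L M : List (DerivStep α)} (h : Isotopic L M) {x y : List α}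
    (hL : P.IsDerivation x L y) {T : List (TrackedLetter α)} (hT : T.map label = x) :
    run T L = run T M := by
  induction h with
  | rel _ _ h => exact Exchange.run_eq h hL hT
  | refl => rfl
  | symm _ _ h ih => exact (ih ((Isotopic.isDerivation_iff h).2 hL)).symm
  | trans _ _ _ h _ ih ih' =>
    exact (ih hL).trans (ih' ((Isotopic.isDerivation_iff h).1 hL))

theorem Isotopic.length {L M : List (DerivStep α)} (h : Isotopic L M) : L.length = M.length := by
  induction h with
  | rel _ _ h => exact h.length
  | refl => rfl
  | symm _ _ _ ih => exact ih.symm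
  | trans _ _ _ _ _ ih ih' => exact ih.trans ih'

theorem Isotopic.append {L M : List (DerivStep α)} (h : Isotopic L M)
    (A B : List (DerivStep α)) : Isotopic (A ++ L ++ B) (A ++ M ++ B) := by
  induction h with
  | rel _ _ h => exact .rel _ _ (h.append A B)
  | refl => exact .refl _
  | symm _ _ _ ih => exact ih.symm
  | trans _ _ _ _ _ ih ih' => exact ih.trans _ _ _ ih'

/-- An exchange involves two steps, so a single step admits none. -/
theorem Isotopic.eq_of_singleton {L M : List (DerivStep α)} (h : Isotopic L M)
    (hL : L.length = 1) : L = M := by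
  induction h with
  | rel _ _ h => cases h; simp only [List.length_append, List.length_cons] at hL; omega
  | refl => rfl
  | symm _ _ h ih => exact (ih ((Isotopic.length h).trans hL)).symm
  | trans _ _ _ h _ ih ih' => exact (ih hL).trans (ih' ((Isotopic.length h).symm.trans hL))

/-! ### Diagrams acting on tracked words. -/

/-- Tracked words over the word `x` without cancelling cells in their history. -/
abbrev TrackedWord (x : List α) : Type u :=
  {T : List (TrackedLetter α) // T.map label = x ∧ ∀ t ∈ T, Good t}

/-- The tracked word that consists of the letters of `x`. -/
def baseWord (x : List α) : TrackedWord x :=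
  ⟨x.map base, map_label_base x, fun t ht => by
    obtain ⟨s, -, rfl⟩ := List.mem_map.1 ht
    exact Good.base s⟩

namespace Diagram

/-- The diagram drawn by a derivation. -/
def ofDerivation {x y : List α} {L : List (DerivStep α)} (h : P.IsDerivation x L y) :
    P.Diagram x y := Quot.mk _ ⟨L, h⟩

theorem exists_ofDerivation {x y : List α} (D : P.Diagram x y) :
    ∃ (L : List (DerivStep α)) (h : P.IsDerivation x L y), D = ofDerivation h := by
  induction D using Quot.ind with
  | mk L => exact ⟨L.1, L.2, rfl⟩

/-- `Isotopic` chains pass through bare lists of steps, but exchanges preserve being a derivation,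
so these chains stay in the type whose quotient defines diagrams. -/
theorem ofDerivation_eq_iff {x y : List α} {L M : List (DerivStep α)} (hL : P.IsDerivation x L y)
    (hM : P.IsDerivation x M y) : ofDerivation hL = ofDerivation hM ↔ Isotopic L M := by
  constructor
  · intro h
    have := Quot.eqvGen_exact h
    suffices H : ∀ A B : {L : List (DerivStep α) // P.IsDerivation x L y},
        Relation.EqvGen (fun A B => Exchange A.1 B.1) A B → Isotopic A.1 B.1 from H _ _ this
    intro A B h
    induction h with
    | rel _ _ h => exact .rel _ _ h
    | refl => exact .refl _
    | symm _ _ _ ih => exact ih.symm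
    | trans _ _ _ _ _ ih ih' => exact ih.trans _ _ _ ih'
  · intro h
    induction h with
    | rel _ _ h => exact Quot.sound h
    | refl => rfl
    | symm _ _ _ ih => exact (ih hM hL).symm
    | trans _ _ _ h _ ih ih' =>
      have := (Isotopic.isDerivation_iff h).1 hL
      exact (ih hL this).trans (ih' this hM)

/-- The action of a diagram on tracked words. -/
noncomputable def run {x y : List α} (D : P.Diagram x y)
    (T : TrackedWord x) :
    TrackedWord y :=
  Quot.lift (fun L : {L : List (DerivStep α) // P.IsDerivation x L y} =>
    ⟨TrackedLetter.run T.1 L.1, L.2.map_label_run T.2.1,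
    L.2.good_run T.2.1 T.2.2⟩) (fun L _ h => Subtype.ext (Exchange.run_eq h L.2 T.2.1)) D

theorem run_comp {x y z : List α} (D : P.Diagram x y) (E : P.Diagram y z)
    (T : TrackedWord x) :
    (D.comp E).run T = E.run (D.run T) := by
  induction D using Quot.ind
  induction E using Quot.ind
  exact Subtype.ext (run_append _ _ _)

theorem exists_step {x y : List α} {A : P.Diagram x y} (hA : A.numCells = 1) :
    ∃ (e : DerivStep α) (h : P.IsDerivation x [e] y), A = ofDerivation h := by
  obtain ⟨L, h, rfl⟩ := A.exists_ofDerivation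
  obtain ⟨e, rfl⟩ := List.length_eq_one_iff.1 hA
  exact ⟨e, h, rfl⟩

theorem run_comp_mirror {x y : List α} {A : P.Diagram x y} (hA : A.numCells = 1)
    (T : TrackedWord x) :
    (A.comp A.mirror).run T = T := by
  obtain ⟨e, h, rfl⟩ := exists_step hA
  obtain ⟨T, hT, hg⟩ := T
  apply Subtype.ext
  change applyStep (applyStep T e) e.inv = T
  obtain ⟨h1, rfl, -⟩ := h
  obtain ⟨A, B, C, rfl, hA, hB, hC⟩ := exists_split hT
  have hB' : B ≠ [] := by
    rintro rfl
    exact h1.ne_nil.1 hB.symm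
  rw [applyStep_append hA hB, applyStep_append (e := e.inv) hA (map_label_cellMap e.bot B)]
  simp only [inv]
  rw [← hB, cellMap_cellMap h1.ne_nil.2 hB' fun t ht => hg t (by simp [ht])]

theorem ReducesDipole.run_eq {x y : List α} {D E : P.Diagram x y} (h : D.ReducesDipole E)
    (T : TrackedWord x) :
    D.run T = E.run T := by
  obtain ⟨z, t, D₁, A, D₂, hA, rfl, rfl⟩ := h
  rw [run_comp, run_comp, run_comp_mirror hA, run_comp]

theorem run_eq_of_toClass_eq {x y : List α} {D E : P.Diagram x y} (h : D.toClass = E.toClass)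
    (T : TrackedWord x) :
    D.run T = E.run T :=
  congrArg (Quot.lift (fun D : P.Diagram x y => D.run T) fun _ _ h => h.run_eq T) h

end Diagram

/-! ### Recovering a reduced derivation from its action. -/

/-- A derivation is reduced if no isotopic derivation has two consecutive inverse steps. -/
def IsReducedDerivation (L : List (DerivStep α)) : Prop :=
  ¬ ∃ A e B, Isotopic L (A ++ e :: DerivStep.inv e :: B)

theorem Diagram.IsReduced.isReducedDerivation {x y : List α} {L : List (DerivStep α)}
    {h : P.IsDerivation x L y} (hr : (ofDerivation h).IsReduced) : IsReducedDerivation L := by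
  rintro ⟨A, e, B, hi⟩
  have h' := (Isotopic.isDerivation_iff hi).1 h
  obtain ⟨z, h1, h2⟩ := isDerivation_append.1 h'
  obtain ⟨h3, rfl, h4⟩ := h2
  obtain ⟨-, -, h5⟩ := h4
  refine hr ⟨(ofDerivation h1).comp (ofDerivation h5), _, _, ofDerivation h1,
    ofDerivation (L := [e]) (isDerivation_singleton.2 ⟨h3, rfl, rfl⟩), ofDerivation h5, rfl,
    ?_, rfl⟩
  have : (ofDerivation h' : P.Diagram x y) = _ := ((ofDerivation_eq_iff h h').2 hi).symm
  rw [← this]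
  exact congrArg (Quot.mk _) (Subtype.ext (by simp))

theorem IsReducedDerivation.of_append {L M : List (DerivStep α)}
    (h : IsReducedDerivation (L ++ M)) : IsReducedDerivation L := by
  rintro ⟨A, e, B, hi⟩
  exact h ⟨A, e, B ++ M, by simpa using Isotopic.append hi [] M⟩

theorem IsReducedDerivation.of_isotopic {L M : List (DerivStep α)}
    (h : IsReducedDerivation L) (hi : Isotopic L M) : IsReducedDerivation M := by
  rintro ⟨A, e, B, hi'⟩
  exact h ⟨A, e, B, hi.trans _ _ _ hi'⟩

/-- A full output in the bottom word of a reduced derivation belongs to a cell that can be drawn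
last. -/
theorem IsReducedDerivation.exists_isotopic {L : List (DerivStep α)}
    (hr : IsReducedDerivation L) {x y : List α} (hL : P.IsDerivation x L y)
    {A M C : List (TrackedLetter α)} {u : List α} (hu : u ≠ [])
    (h : run (x.map base) L = A ++ outs M u ++ C) :
    ∃ L', Isotopic L (L' ++ [⟨A.map label, M.map label, u, C.map label⟩]) ∧
      run (x.map base) L' = A ++ M ++ C := by
  induction L using List.reverseRecOn generalizing y A M C u with
  | nil =>
    obtain ⟨j, c, hj⟩ := exists_mem_outs M hu
    have : out M u j c ∈ run (x.map base) [] := by rw [h]; simp [hj]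
    simp at this
  | append_singleton L f ih =>
    obtain ⟨z, hL', hf⟩ := isDerivation_append.1 hL
    obtain ⟨hf1, rfl, rfl⟩ := isDerivation_singleton.1 hf
    obtain ⟨S, B, S', hS, hS1, hB, hS2⟩ :=
      exists_split (hL'.map_label_run (map_label_base x))
    rw [run_append, hS, run_cons, run_nil, applyStep_append hS1 hB] at h
    have hfe : f = ⟨S.map label, B.map label, f.bot, S'.map label⟩ := by rw [hS1, hB, hS2]
    -- If `f` cancelled, its top would be the full output of an inverse cell; by induction that cell
    -- could be drawn just before `f`, giving a dipole.
    have hc : ¬ ∃ N, IsOutput f.bot B N := by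
      rintro ⟨N, hN1, hN2⟩
      rw [hN2, hB] at hS
      obtain ⟨L', hi, -⟩ := ih hr.of_append hL' hf1.ne_nil.1 hS
      refine hr ⟨L', f.inv, [], ?_⟩
      have := Isotopic.append hi [] [f]
      rw [hN1, hS1, hS2] at this
      simpa [inv] using this
    rw [cellMap_eq_outs hc] at h
    rcases outs_overlap hf1.ne_nil.2 hu h with
      ⟨rfl, rfl, rfl, rfl⟩ | ⟨K, rfl, rfl⟩ | ⟨K, rfl, rfl⟩
    · exact ⟨L, by rw [← hfe]; exact .refl _, hS⟩
    -- The block is disjoint from the output of `f`, so it was present before `f`. Its cell is drawn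
    -- just before `f` by induction and then exchanged with `f`; the next case is the mirror
    -- situation.
    · rw [← List.append_assoc, ← List.append_assoc] at hS
      obtain ⟨L', hi, hrun⟩ := ih hr.of_append hL' hu hS
      refine ⟨L' ++ [⟨S.map label, B.map label, f.bot,
        K.map label ++ M.map label ++ C.map label⟩], ?_, ?_⟩
      · have h1 := Isotopic.append hi [] [f]
        have h2 := Exchange.mk L' [] (S.map label) (B.map label) f.bot (K.map label)
          (M.map label) u (C.map label)
        refine h1.trans _ _ _ ?_
        rw [hfe]
        refine .symm _ _ (.rel _ _ ?_)
        simpa using h2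
      · rw [run_append, hrun, run_cons, run_nil]
        have : applyStep (S ++ B ++ (K ++ M ++ C)) ⟨S.map label, B.map label, f.bot,
          K.map label ++ M.map label ++ C.map label⟩ = _ := applyStep_append rfl rfl _
        rw [cellMap_eq_outs hc] at this
        simpa using this
    · have hS' : run (x.map base) L = A ++ outs M u ++ (K ++ B ++ S') := by
        rw [hS]; simp
      obtain ⟨L', hi, hrun⟩ := ih hr.of_append hL' hu hS'
      refine ⟨L' ++ [⟨A.map label ++ M.map label ++ K.map label, B.map label, f.bot,
        S'.map label⟩], ?_, ?_⟩
      · have h1 := Isotopic.append hi [] [f]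
        have h2 := Exchange.mk L' [] (A.map label) (M.map label) u (K.map label)
          (B.map label) f.bot (S'.map label)
        refine h1.trans _ _ _ ?_
        rw [hfe]
        refine .rel _ _ ?_
        simpa using h2
      · rw [run_append, hrun, run_cons, run_nil]
        have : applyStep (A ++ M ++ K ++ B ++ S') ⟨A.map label ++ M.map label ++ K.map label,
          B.map label, f.bot, S'.map label⟩ = _ := applyStep_append (by simp) rfl _
        rw [cellMap_eq_outs hc] at this
        simpa using this

/-- The last step of a reduced derivation does not cancel. -/
theorem IsReducedDerivation.exists_run_eq {L : List (DerivStep α)} {f : DerivStep α}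
    (hr : IsReducedDerivation (L ++ [f])) {x y : List α} (hL : P.IsDerivation x (L ++ [f]) y) :
    ∃ A B C, run (x.map base) L = A ++ B ++ C ∧
      run (x.map base) (L ++ [f]) = A ++ outs B f.bot ++ C ∧
      f = ⟨A.map label, B.map label, f.bot, C.map label⟩ ∧ f.bot ≠ [] := by
  obtain ⟨z, hL', hf⟩ := isDerivation_append.1 hL
  obtain ⟨hf1, rfl, rfl⟩ := isDerivation_singleton.1 hf
  obtain ⟨S, B, S', hS, hS1, hB, hS2⟩ := exists_split (hL'.map_label_run (map_label_base x))
  have hc : ¬ ∃ N, IsOutput f.bot B N := by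
    rintro ⟨N, hN1, hN2⟩
    rw [hN2, hB] at hS
    obtain ⟨L', hi, -⟩ := hr.of_append.exists_isotopic hL' hf1.ne_nil.1 hS
    refine hr ⟨L', f.inv, [], ?_⟩
    have := Isotopic.append hi [] [f]
    rw [hN1, hS1, hS2] at this
    simpa [inv] using this
  refine ⟨S, B, S', hS, ?_, by rw [hS1, hB, hS2], hf1.ne_nil.2⟩
  rw [run_append, hS, run_cons, run_nil, applyStep_append hS1 hB, cellMap_eq_outs hc]

/-- A reduced derivation is determined, up to isotopy, by its action on tracked words. -/
theorem IsReducedDerivation.isotopic_of_run_eq {L M : List (DerivStep α)}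
    (hL : IsReducedDerivation L) (hM : IsReducedDerivation M) {x y : List α}
    (hL' : P.IsDerivation x L y) (hM' : P.IsDerivation x M y)
    (h : run (x.map base) L = run (x.map base) M) : Isotopic L M := by
  induction L using List.reverseRecOn generalizing y M with
  | nil =>
    induction M using List.reverseRecOn with
    | nil => exact .refl _
    | append_singleton M f _ =>
      -- A nonempty reduced derivation leaves an `out` letter, and the initial word has none.
      obtain ⟨A, B, C, -, h2, -, hf⟩ := hM.exists_run_eq hM'
      obtain ⟨j, c, hj⟩ := exists_mem_outs B hf
      have : out B f.bot j c ∈ run (x.map base) [] := by rw [h, h2]; simp [hj]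
      simp at this
  | append_singleton L f ih =>
    obtain ⟨A, B, C, h1, h2, h3, hf⟩ := hL.exists_run_eq hL'
    -- The output of `f` also appears at the end of `M`, so `M` too can be drawn with `f` last;
    -- removing `f` from both leaves shorter derivations with equal actions.
    obtain ⟨M', hi, hM1⟩ := hM.exists_isotopic hM' hf (h.symm.trans h2)
    rw [← h3] at hi
    have hd := (Isotopic.isDerivation_iff hi).1 hM'
    obtain ⟨z, hd1, hd2⟩ := isDerivation_append.1 hd
    obtain ⟨z', hd1', hd2'⟩ := isDerivation_append.1 hL'
    have hz : z' = z := by rw [hd2'.2.1, hd2.2.1]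
    subst hz
    have := ih hL.of_append (hM.of_isotopic hi).of_append hd1' hd1 (h1.trans hM1.symm)
    refine Relation.EqvGen.trans _ _ _ ?_ hi.symm
    simpa using Isotopic.append this [] [f]

/-! ### Uniqueness of reduced diagrams. -/

namespace Diagram

theorem IsReduced.eq_of_run_eq {x y : List α} {D E : P.Diagram x y} (hD : D.IsReduced)
    (hE : E.IsReduced) (h : D.run (baseWord x) = E.run (baseWord x)) : D = E := by
  obtain ⟨L, hL, rfl⟩ := D.exists_ofDerivation
  obtain ⟨M, hM, rfl⟩ := E.exists_ofDerivation
  exact (ofDerivation_eq_iff hL hM).2 (hD.isReducedDerivation.isotopic_of_run_eq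
    hE.isReducedDerivation hL hM (congrArg Subtype.val h))

/-- Equivalent reduced diagrams are equal. -/
theorem IsReduced.eq_of_toClass_eq {x y : List α} {D E : P.Diagram x y} (hD : D.IsReduced)
    (hE : E.IsReduced) (h : D.toClass = E.toClass) : D = E :=
  hD.eq_of_run_eq hE (run_eq_of_toClass_eq h _)

theorem numCells_comp {x y z : List α} (D : P.Diagram x y) (E : P.Diagram y z) :
    (D.comp E).numCells = D.numCells + E.numCells := by
  induction D using Quot.ind
  induction E using Quot.ind
  exact List.length_append

theorem ReducesDipole.numCells_lt {x y : List α} {D E : P.Diagram x y} (h : D.ReducesDipole E) :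
    E.numCells + 2 = D.numCells := by
  obtain ⟨z, t, D₁, A, D₂, hA, rfl, rfl⟩ := h
  simp only [numCells_comp, numCells_mirror, hA]
  omega

theorem exists_isReduced {x y : List α} (D : P.Diagram x y) :
    ∃ E : P.Diagram x y, E.IsReduced ∧ E.toClass = D.toClass := by
  induction hn : D.numCells using Nat.strong_induction_on generalizing D with
  | _ n ih =>
    by_cases h : D.IsReduced
    · exact ⟨D, h, rfl⟩
    · obtain ⟨E, hE⟩ := not_not.1 h
      obtain ⟨E', h1, h2⟩ := ih E.numCells (by have := hE.numCells_lt; omega) E rfl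
      exact ⟨E', h1, h2.trans (Quot.sound hE).symm⟩

/-- Reduction does not change the action, so it suffices to compare reduced representatives: the
action on the base word is a complete invariant of the class. -/
theorem toClass_eq_of_run_eq {x y : List α} {D E : P.Diagram x y}
    (h : D.run (baseWord x) = E.run (baseWord x)) : D.toClass = E.toClass := by
  obtain ⟨D', hD, hD'⟩ := D.exists_isReduced
  obtain ⟨E', hE, hE'⟩ := E.exists_isReduced
  rw [← hD', ← hE', hD.eq_of_run_eq hE]
  exact (run_eq_of_toClass_eq hD' _).trans (h.trans (run_eq_of_toClass_eq hE' _).symm)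

theorem IsReduced.of_comp {x y z : List α} {D : P.Diagram x y} {E : P.Diagram y z}
    (h : (D.comp E).IsReduced) : D.IsReduced := by
  rintro ⟨_, z, t, D₁, A, D₂, hA, rfl, rfl⟩
  exact h ⟨D₁.comp (D₂.comp E), z, t, D₁, A, D₂.comp E, hA, by simp only [comp_assoc], rfl⟩

theorem isReduced_of_numCells_eq_one {x y : List α} {A : P.Diagram x y} (h : A.numCells = 1) :
    A.IsReduced := by
  rintro ⟨E, hE⟩
  have := hE.numCells_lt
  omega

end Diagram

/-! ### Sums, and injectivity of the canonical homomorphism. -/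

theorem IsDerivation.run_addRight {x y : List α} {L : List (DerivStep α)}
    (h : P.IsDerivation x L y) {T : List (TrackedLetter α)} (hT : T.map label = x)
    (z : List α) (S : List (TrackedLetter α)) :
    run (T ++ S) (L.map (DerivStep.addRight z)) = run T L ++ S := by
  induction L generalizing x T with
  | nil => rfl
  | cons e L ih =>
    obtain ⟨-, rfl, h3⟩ := h
    obtain ⟨A, B, C, rfl, hA, hB, hC⟩ := exists_split hT
    have : applyStep (A ++ B ++ (C ++ S)) (DerivStep.addRight z e) = _ :=
      applyStep_append (e := DerivStep.addRight z e) hA hB _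
    rw [List.map_cons, run_cons, List.append_assoc, this, run_cons, applyStep_append hA hB,
      ← ih h3 (by simp [hA, hC])]
    simp [DerivStep.addRight]

theorem IsDerivation.run_addLeft {x y : List α} {L : List (DerivStep α)}
    (h : P.IsDerivation x L y) {T : List (TrackedLetter α)} (hT : T.map label = x)
    {z : List α} {S : List (TrackedLetter α)} (hS : S.map label = z) :
    run (S ++ T) (L.map (DerivStep.addLeft z)) = S ++ run T L := by
  induction L generalizing x T with
  | nil => rfl
  | cons e L ih =>
    obtain ⟨-, rfl, h3⟩ := h
    obtain ⟨A, B, C, rfl, hA, hB, hC⟩ := exists_split hT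
    have : applyStep (S ++ A ++ B ++ C) (DerivStep.addLeft z e) = _ :=
      applyStep_append (e := DerivStep.addLeft z e) (by simp [hA, hS, DerivStep.addLeft]) hB _
    rw [List.map_cons, run_cons, ← List.append_assoc, ← List.append_assoc, this, run_cons,
      applyStep_append hA hB, ← ih h3 (by simp [hA, hC])]
    simp [DerivStep.addLeft]

theorem Diagram.run_sum {x y x' y' : List α} (D : P.Diagram x y) (E : P.Diagram x' y')
    (T : TrackedWord x) (S : TrackedWord x') (R : TrackedWord (x ++ x')) (h : R.1 = T.1 ++ S.1) :
    ((D.sum E).run R).1 = (D.run T).1 ++ (E.run S).1 := by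
  obtain ⟨L, hL, rfl⟩ := D.exists_ofDerivation
  obtain ⟨M, hM, rfl⟩ := E.exists_ofDerivation
  change TrackedLetter.run R.1 (L.map (DerivStep.addRight x') ++ M.map (DerivStep.addLeft y)) =
    TrackedLetter.run T.1 L ++ TrackedLetter.run S.1 M
  rw [h, run_append, hL.run_addRight T.2.1, hM.run_addLeft S.2.1 (hL.map_label_run T.2.1)]

/-- The sum acts on the base word by concatenating the actions of its summands, so the actions of
`A` and `B`, and with them their classes, can be read off. -/
theorem canonicalHom_injective (a u b : List α) : Function.Injective (P.canonicalHom a u b) := by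
  rintro ⟨A, B⟩ ⟨A', B'⟩ h
  induction A using Quot.ind with | mk D =>
  induction B using Quot.ind with | mk E =>
  induction A' using Quot.ind with | mk D' =>
  induction B' using Quot.ind with | mk E' =>
  have h' : ((D.sum (Diagram.trivial P u)).sum E).toClass =
    ((D'.sum (Diagram.trivial P u)).sum E').toClass := h
  have key : ∀ (D : P.Diagram a a) (E : P.Diagram b b),
      (((D.sum (Diagram.trivial P u)).sum E).run (baseWord (a ++ u ++ b))).1 =
        (D.run (baseWord a)).1 ++ u.map base ++ (E.run (baseWord b)).1 := by
    intro D E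
    rw [Diagram.run_sum _ _ (baseWord (a ++ u)) (baseWord b) _ (by simp [baseWord]),
      Diagram.run_sum _ _ (baseWord a) (baseWord u) _ (by simp [baseWord])]
    rfl
  have h2 := congrArg Subtype.val (Diagram.run_eq_of_toClass_eq h' (baseWord _))
  rw [key, key, List.append_assoc, List.append_assoc] at h2
  -- The first blocks have equal length, so equal concatenations split into equal blocks.
  have hl : ∀ D : P.Diagram a a, (D.run (baseWord a)).1.length = a.length := fun D => by
    rw [← List.length_map (f := label), (D.run (baseWord a)).2.1]
  obtain ⟨h3, h4⟩ := List.append_inj h2 ((hl D).trans (hl D').symm)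
  exact Prod.ext (Diagram.toClass_eq_of_run_eq (Subtype.ext h3))
    (Diagram.toClass_eq_of_run_eq (Subtype.ext (List.append_cancel_left h4)))

/-! ### Vertices of the Farley complex joined by derivations. -/

variable {w : List α}

namespace FarleyVertex

/-- `W = V · D`, where `D` is the diagram drawn by the derivation `L`. -/
def Steps (V : P.FarleyVertex w) (L : List (DerivStep α)) (W : P.FarleyVertex w) : Prop :=
  ∃ h : P.IsDerivation V.1 L W.1, W.2 = V.2.comp (Diagram.ofDerivation h).toClass

theorem steps_comp {x y : List α} (V : P.DiagramClass w x) {D : P.Diagram x y}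
    {L : List (DerivStep α)} {h : P.IsDerivation x L y} (hD : D = Diagram.ofDerivation h) :
    Steps (⟨x, V⟩ : P.FarleyVertex w) L ⟨y, V.comp D.toClass⟩ :=
  ⟨h, by rw [hD]⟩

theorem Steps.unique {V W W' : P.FarleyVertex w} {L : List (DerivStep α)} (h : V.Steps L W)
    (h' : V.Steps L W') : W = W' := by
  obtain ⟨y, W⟩ := W
  obtain ⟨y', W'⟩ := W'
  obtain ⟨h1, h2⟩ := h
  obtain ⟨h1', h2'⟩ := h'
  -- The derivation alone determines the final label: it is the label of the tracked word obtained
  -- by running it.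
  have : y = y' :=
    (h1.map_label_run (map_label_base _)).symm.trans (h1'.map_label_run (map_label_base _))
  subst this
  exact Sigma.ext rfl (heq_of_eq (h2.trans h2'.symm))

theorem exists_steps (V : P.FarleyVertex w) {L : List (DerivStep α)} {y : List α}
    (h : P.IsDerivation V.1 L y) : ∃ W : P.FarleyVertex w, V.Steps L W :=
  ⟨⟨y, V.2.comp (Diagram.ofDerivation h).toClass⟩, h, rfl⟩

theorem steps_append {V W : P.FarleyVertex w} {L M : List (DerivStep α)} :
    V.Steps (L ++ M) W ↔ ∃ U, V.Steps L U ∧ U.Steps M W := by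
  constructor
  · rintro ⟨h, hW⟩
    obtain ⟨y, h1, h2⟩ := isDerivation_append.1 h
    refine ⟨⟨y, V.2.comp (Diagram.ofDerivation h1).toClass⟩, ⟨h1, rfl⟩, h2, ?_⟩
    rw [hW, DiagramClass.comp_assoc]
    rfl
  · rintro ⟨U, ⟨h1, hU⟩, h2, hW⟩
    refine ⟨h1.append h2, ?_⟩
    rw [hW, hU, DiagramClass.comp_assoc]
    rfl

theorem Steps.of_isotopic {V W : P.FarleyVertex w} {L M : List (DerivStep α)} (hi : Isotopic L M)
    (h : V.Steps L W) : V.Steps M W := by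
  obtain ⟨h1, hW⟩ := h
  have h2 := (Isotopic.isDerivation_iff hi).1 h1
  exact ⟨h2, by rw [hW, (Diagram.ofDerivation_eq_iff h1 h2).2 hi]⟩

theorem Steps.symm {V W : P.FarleyVertex w} {e : DerivStep α} (h : V.Steps [e] W) :
    W.Steps [e.inv] V := by
  obtain ⟨h, hW⟩ := h
  refine ⟨h.mirror, ?_⟩
  have : (Diagram.ofDerivation h.mirror).toClass = (Diagram.ofDerivation h).toClass.inv := rfl
  change V.2 = W.2.comp (Diagram.ofDerivation h.mirror).toClass
  rw [this, hW, DiagramClass.comp_assoc, DiagramClass.comp_inv, DiagramClass.comp_trivial]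

/-- After cancelling `V` on the left, two one-cell diagrams have the same class. Both are reduced,
hence equal, and a single step is isotopic only to itself. So an oriented edge knows its cell and
the position of that cell. -/
theorem Steps.step_unique {V W : P.FarleyVertex w} {e e' : DerivStep α} (h : V.Steps [e] W)
    (h' : V.Steps [e'] W) : e = e' := by
  obtain ⟨h, hW⟩ := h
  obtain ⟨h', hW'⟩ := h'
  have h1 := congrArg (DiagramClass.comp V.2.inv) (hW.symm.trans hW')
  rw [← DiagramClass.comp_assoc, ← DiagramClass.comp_assoc, DiagramClass.inv_comp,
    DiagramClass.trivial_comp, DiagramClass.trivial_comp] at h1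
  have h2 := (Diagram.isReduced_of_numCells_eq_one rfl).eq_of_toClass_eq
    (Diagram.isReduced_of_numCells_eq_one rfl) h1
  have h3 := Isotopic.eq_of_singleton ((Diagram.ofDerivation_eq_iff _ _).1 h2) rfl
  simpa using h3

theorem Steps.smul {V W : P.FarleyVertex w} {L : List (DerivStep α)} (h : V.Steps L W)
    (g : P.DiagramGroup w) : (g • V).Steps L (g • W) := by
  obtain ⟨h, hW⟩ := h
  refine ⟨h, ?_⟩
  change g.comp W.2 = (g.comp V.2).comp _
  rw [hW, DiagramClass.comp_assoc]

end FarleyVertex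

open FarleyVertex

/-! ### Squares and parallel edges. -/

/-- `s` and `t` are steps that act on disjoint subwords of the same word; `s'` and `t'` are the
corresponding steps after `t` and `s`, respectively. -/
inductive Independent : DerivStep α → DerivStep α → DerivStep α → DerivStep α → Prop
  | left (p u v q u' v' r : List α) :
      Independent ⟨p, u, v, q ++ u' ++ r⟩ ⟨p ++ u ++ q, u', v', r⟩ ⟨p, u, v, q ++ v' ++ r⟩
        ⟨p ++ v ++ q, u', v', r⟩
  | right (p u v q u' v' r : List α) :
      Independent ⟨p ++ u ++ q, u', v', r⟩ ⟨p, u, v, q ++ u' ++ r⟩ ⟨p ++ v ++ q, u', v', r⟩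
        ⟨p, u, v, q ++ v' ++ r⟩

theorem Independent.isotopic {s t s' t' : DerivStep α} (h : Independent s t s' t') :
    Isotopic [t, s'] [s, t'] := by
  cases h with
  | left p u v q u' v' r => exact .symm _ _ (.rel _ _ (Exchange.mk [] [] p u v q u' v' r))
  | right p u v q u' v' r => exact .rel _ _ (Exchange.mk [] [] p u v q u' v' r)

/-- The same square, read from the corner reached by `t`. -/
theorem Independent.inv_right {s t s' t' : DerivStep α} (h : Independent s t s' t') :
    Independent s' t.inv s t'.inv := by
  cases h with
  | left p u v q u' v' r => exact .left p u v q v' u' r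
  | right p u v q u' v' r => exact .right p v u q u' v' r

/-- The same square, read from the corner reached by `s`. -/
theorem Independent.inv_left {s t s' t' : DerivStep α} (h : Independent s t s' t') :
    Independent s.inv t' s'.inv t := by
  cases h with
  | left p u v q u' v' r => exact .left p v u q u' v' r
  | right p u v q u' v' r => exact .right p u v q v' u' r

theorem Independent.isDerivation {s t s' t' : DerivStep α} (h : Independent s t s' t')
    {x y z : List α} (hs : P.IsDerivation x [s] y) (ht : P.IsDerivation x [t] z) :
    P.IsDerivation z [s'] (s'.left ++ s'.bot ++ s'.right) := by
  rw [isDerivation_singleton] at *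
  cases h <;> exact ⟨hs.1, by simp [ht.2.2], rfl⟩

/-- Opposite sides of a square, in terms of steps. -/
theorem parallel_iff {e f : Sym2 (P.FarleyVertex w)} :
    Parallel w e f ↔ ∃ (s t s' t' : DerivStep α) (V W V' W' : P.FarleyVertex w),
      Independent s t s' t' ∧ V.Steps [s] W ∧ V.Steps [t] V' ∧ V'.Steps [s'] W' ∧
        e = s(V, W) ∧ f = s(V', W') := by
  -- The four sides of the square spanned by `A + B`, each written as one step; the third one relies
  -- on the interchange law for sums.
  have main : ∀ {x y x' y' : List α} (V : P.DiagramClass w (x ++ x')) (s t : DerivStep α)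
      (hs : P.IsDerivation x [s] y) (ht : P.IsDerivation x' [t] y'),
      Steps (⟨_, V⟩ : P.FarleyVertex w) [⟨s.left, s.top, s.bot, s.right ++ t.left ++ t.top ++
        t.right⟩] ⟨_, V.comp ((Diagram.ofDerivation hs).sum (.trivial P x')).toClass⟩ ∧
      Steps (⟨_, V⟩ : P.FarleyVertex w) [⟨s.left ++ s.top ++ (s.right ++ t.left), t.top, t.bot,
        t.right⟩] ⟨_, V.comp ((Diagram.trivial P x).sum (Diagram.ofDerivation ht)).toClass⟩ ∧
      Steps (⟨_, V.comp ((Diagram.trivial P x).sum (Diagram.ofDerivation ht)).toClass⟩ :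
        P.FarleyVertex w) [⟨s.left, s.top, s.bot, s.right ++ t.left ++ t.bot ++ t.right⟩]
        ⟨_, V.comp ((Diagram.ofDerivation hs).sum (Diagram.ofDerivation ht)).toClass⟩ ∧
      Steps (⟨_, V.comp ((Diagram.ofDerivation hs).sum (.trivial P x')).toClass⟩ :
        P.FarleyVertex w) [⟨s.left ++ s.bot ++ (s.right ++ t.left), t.top, t.bot, t.right⟩]
        ⟨_, V.comp ((Diagram.ofDerivation hs).sum (Diagram.ofDerivation ht)).toClass⟩ := by
    intro x y x' y' V s t hs ht
    have hs' := isDerivation_singleton.1 hs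
    have ht' := isDerivation_singleton.1 ht
    obtain ⟨hsc, rfl, rfl⟩ := hs'
    obtain ⟨htc, rfl, rfl⟩ := ht'
    refine ⟨?_, ?_, ?_, ?_⟩
    · exact steps_comp V (h := isDerivation_singleton.2 ⟨hsc, by simp, by simp⟩)
        (congrArg (Quot.mk _) (Subtype.ext (by simp [DerivStep.addRight])))
    · exact steps_comp V (h := isDerivation_singleton.2 ⟨htc, by simp, by simp⟩)
        (congrArg (Quot.mk _) (Subtype.ext (by simp [DerivStep.addLeft])))
    · refine ⟨isDerivation_singleton.2 ⟨hsc, by simp, by simp⟩, ?_⟩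
      rw [DiagramClass.comp_assoc, Diagram.sum, Diagram.addTrivial_comp_trivialAdd]
      exact congrArg V.comp (congrArg (Quot.mk _) (congrArg (Quot.mk _) (Subtype.ext
        (by simp [DerivStep.addLeft, DerivStep.addRight]))))
    · refine ⟨isDerivation_singleton.2 ⟨htc, by simp, by simp⟩, ?_⟩
      rw [DiagramClass.comp_assoc]
      exact congrArg V.comp (congrArg (Quot.mk _) (congrArg (Quot.mk _) (Subtype.ext
        (by simp [DerivStep.addLeft, DerivStep.addRight]))))
  constructor
  · rintro (⟨V, A, B, hA, hB⟩ | ⟨V, A, B, hA, hB⟩)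
    · obtain ⟨s, hs, rfl⟩ := Diagram.exists_step hA
      obtain ⟨t, ht, rfl⟩ := Diagram.exists_step hB
      obtain ⟨h1, h2, h3, -⟩ := main V s t hs ht
      exact ⟨_, _, _, _, _, _, _, _,
        Independent.left s.left s.top s.bot (s.right ++ t.left) t.top t.bot t.right,
        h1, h2, h3, rfl, rfl⟩
    · obtain ⟨s, hs, rfl⟩ := Diagram.exists_step hA
      obtain ⟨t, ht, rfl⟩ := Diagram.exists_step hB
      obtain ⟨h1, h2, -, h4⟩ := main V s t hs ht
      exact ⟨_, _, _, _, _, _, _, _,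
        Independent.right s.left s.top s.bot (s.right ++ t.left) t.top t.bot t.right,
        h2, h1, h4, rfl, rfl⟩
  · rintro ⟨s, t, s', t', V, W, V', W', hi, h1, h2, h3, rfl, rfl⟩
    cases hi with
    | left p u v q u' v' r =>
      obtain ⟨hc, hx, -⟩ := isDerivation_singleton.1 h1.1
      obtain ⟨hc', -, -⟩ := isDerivation_singleton.1 h2.1
      obtain ⟨x, V⟩ := V
      -- Any cut between `u` and `u'` presents the two cells as a sum; it is made here just before
      -- `u'`, so the second summand has empty left context.
      replace hx : x = (p ++ u ++ q) ++ (u' ++ r) := by simpa using hx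
      subst hx
      have hs : P.IsDerivation (p ++ u ++ q) [⟨p, u, v, q⟩] (p ++ v ++ q) :=
        isDerivation_singleton.2 ⟨hc, rfl, rfl⟩
      have ht : P.IsDerivation (u' ++ r) [⟨[], u', v', r⟩] (v' ++ r) :=
        isDerivation_singleton.2 ⟨hc', rfl, rfl⟩
      obtain ⟨m1, m2, m3, -⟩ := main V _ _ hs ht
      simp only [List.append_nil] at m1 m2 m3
      obtain rfl := h1.unique m1
      obtain rfl := h2.unique m2
      obtain rfl := h3.unique m3
      exact Parallel.left V _ _ rfl rfl
    | right p u v q u' v' r =>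
      obtain ⟨hc, hx, -⟩ := isDerivation_singleton.1 h2.1
      obtain ⟨hc', -, -⟩ := isDerivation_singleton.1 h1.1
      obtain ⟨x, V⟩ := V
      replace hx : x = (p ++ u ++ q) ++ (u' ++ r) := by simpa using hx
      subst hx
      have hs : P.IsDerivation (p ++ u ++ q) [⟨p, u, v, q⟩] (p ++ v ++ q) :=
        isDerivation_singleton.2 ⟨hc, rfl, rfl⟩
      have ht : P.IsDerivation (u' ++ r) [⟨[], u', v', r⟩] (v' ++ r) :=
        isDerivation_singleton.2 ⟨hc', rfl, rfl⟩
      obtain ⟨m1, m2, -, m4⟩ := main V _ _ hs ht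
      simp only [List.append_nil] at m1 m2 m4
      obtain rfl := h1.unique m2
      obtain rfl := h2.unique m1
      obtain rfl := h3.unique m4
      exact Parallel.right V _ _ rfl rfl

theorem Parallel.symm {e f : Sym2 (P.FarleyVertex w)} (h : Parallel w e f) : Parallel w f e := by
  obtain ⟨s, t, s', t', V, W, V', W', hi, h1, h2, h3, rfl, rfl⟩ := parallel_iff.1 h
  exact parallel_iff.2 ⟨_, _, _, _, V', W', V, W, hi.inv_right, h3, h2.symm, h1, rfl, rfl⟩

/-- The other side of a square, oriented along a given orientation of the first side. -/
theorem Parallel.exists_steps {V W : P.FarleyVertex w} {s : DerivStep α}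
    {f : Sym2 (P.FarleyVertex w)} (h : Parallel w s(V, W) f) (hs : V.Steps [s] W) :
    ∃ (t s' t' : DerivStep α) (V' W' : P.FarleyVertex w), Independent s t s' t' ∧
      V.Steps [t] V' ∧ V'.Steps [s'] W' ∧ f = s(V', W') := by
  obtain ⟨s₁, t, s', t', V₁, W₁, V', W', hi, h1, h2, h3, he, rfl⟩ := parallel_iff.1 h
  rcases Sym2.eq_iff.1 he with ⟨rfl, rfl⟩ | ⟨rfl, rfl⟩
  · obtain rfl := hs.step_unique h1
    exact ⟨t, s', t', V', W', hi, h2, h3, rfl⟩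
  -- The given orientation is opposite to that of the square, which is therefore read from the
  -- corner `W` instead of `V`.
  · obtain rfl := hs.step_unique h1.symm
    obtain ⟨U, hU, hU'⟩ := steps_append.1
      (Steps.of_isotopic (M := [s₁] ++ [t']) hi.isotopic (steps_append.2 ⟨_, h2, h3⟩))
    obtain rfl := hU.unique h1
    exact ⟨t', s'.inv, t, W', V', hi.inv_left, hU', h3.symm, Sym2.eq_swap⟩

/-- Squares are described by right multiplication, which commutes with the left action of the group.
-/
theorem eqvGen_parallel_smul (g : P.DiagramGroup w) {e f : Sym2 (P.FarleyVertex w)}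
    (h : Relation.EqvGen (Parallel w) e f) :
    Relation.EqvGen (Parallel w) (e.map fun V => g • V) (f.map fun V => g • V) := by
  induction h with
  | rel _ _ h =>
    obtain ⟨s, t, s', t', V, W, V', W', hi, h1, h2, h3, rfl, rfl⟩ := parallel_iff.1 h
    exact .rel _ _ (parallel_iff.2
      ⟨s, t, s', t', _, _, _, _, hi, h1.smul g, h2.smul g, h3.smul g, rfl, rfl⟩)
  | refl => exact .refl _
  | symm _ _ _ ih => exact ih.symm
  | trans _ _ _ _ _ ih ih' => exact ih.trans _ _ _ ih'

/-- An edge is parallel to its translate by a diagram glued on the left of its cell. -/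
theorem exists_parallel_addRight {u v d c' : List α} {L : List (DerivStep α)} {c : List α}
    (hL : P.IsDerivation c L c') {V W V' : P.FarleyVertex w} (hW : V.Steps [⟨c, u, v, d⟩] W)
    (hV : V.Steps (L.map (DerivStep.addRight (u ++ d))) V') :
    ∃ W', V'.Steps [⟨c', u, v, d⟩] W' ∧ Relation.EqvGen (Parallel w) s(V, W) s(V', W') := by
  induction L generalizing c V W with
  | nil =>
    cases hL
    obtain rfl := hV.unique ⟨rfl, (DiagramClass.comp_trivial _).symm⟩
    exact ⟨W, hW, .refl _⟩
  | cons t L ih =>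
    obtain ⟨ht, rfl, hL⟩ := hL
    rw [List.map_cons, ← List.singleton_append] at hV
    obtain ⟨U, hU, hV⟩ := steps_append.1 hV
    -- The next cell of `L` and the cell of the edge span a square; its far side is the edge for the
    -- induction hypothesis.
    have hi := Independent.right t.left t.top t.bot t.right u v d
    have hU' : V.Steps [⟨t.left, t.top, t.bot, t.right ++ u ++ d⟩] U := by
      simpa [DerivStep.addRight] using hU
    obtain ⟨U', hU₁⟩ := exists_steps U (hi.isDerivation hW.1 hU'.1)
    obtain ⟨W', h1, h2⟩ := ih hL hU₁ hV
    exact ⟨W', h1, .trans _ _ _ (.rel _ _ (parallel_iff.2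
      ⟨_, _, _, _, _, _, _, _, hi, hW, hU', hU₁, rfl, rfl⟩)) h2⟩

/-- An edge is parallel to its translate by a diagram glued on the right of its cell. -/
theorem exists_parallel_addLeft {c u v d' : List α} {L : List (DerivStep α)} {d : List α}
    (hL : P.IsDerivation d L d') {V W V' : P.FarleyVertex w} (hW : V.Steps [⟨c, u, v, d⟩] W)
    (hV : V.Steps (L.map (DerivStep.addLeft (c ++ u))) V') :
    ∃ W', V'.Steps [⟨c, u, v, d'⟩] W' ∧ Relation.EqvGen (Parallel w) s(V, W) s(V', W') := by
  induction L generalizing d V W with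
  | nil =>
    cases hL
    obtain rfl := hV.unique ⟨rfl, (DiagramClass.comp_trivial _).symm⟩
    exact ⟨W, hW, .refl _⟩
  | cons t L ih =>
    obtain ⟨ht, rfl, hL⟩ := hL
    rw [List.map_cons, ← List.singleton_append] at hV
    obtain ⟨U, hU, hV⟩ := steps_append.1 hV
    have hi := Independent.left c u v t.left t.top t.bot t.right
    have hU' : V.Steps [⟨c ++ u ++ t.left, t.top, t.bot, t.right⟩] U := hU
    obtain ⟨U', hU₁⟩ := exists_steps U (hi.isDerivation hW.1 hU'.1)
    obtain ⟨W', h1, h2⟩ := ih hL hU₁ hV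
    exact ⟨W', h1, .trans _ _ _ (.rel _ _ (parallel_iff.2
      ⟨_, _, _, _, _, _, _, _, hi, hW, hU', hU₁, rfl, rfl⟩)) h2⟩

/-! ### Edges parallel to a given edge. -/

/-- The vertices `D · (A + ε(u) + B)`, where `A` is an `(a, a')`-diagram and `B` is a
`(b, b')`-diagram. -/
def IsTranslate {a u b : List α} (D : P.DiagramClass w (a ++ u ++ b)) (a' b' : List α)
    (V : P.FarleyVertex w) : Prop :=
  ∃ (A : P.DiagramClass a a') (B : P.DiagramClass b b'),
    V = ⟨a' ++ u ++ b', D.comp ((A.sum (Diagram.trivial P u).toClass).sum B)⟩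

/-- A cell glued to the left of `u` is absorbed into `A`, by the interchange law. -/
theorem IsTranslate.addRight {a u b : List α} {D : P.DiagramClass w (a ++ u ++ b)}
    {p u₁ v₁ q b' : List α} {V V' : P.FarleyVertex w}
    (h : IsTranslate D (p ++ u₁ ++ q) b' V) (hV : V.Steps [⟨p, u₁, v₁, q ++ u ++ b'⟩] V') :
    IsTranslate D (p ++ v₁ ++ q) b' V' := by
  obtain ⟨A, B, rfl⟩ := h
  have hc := (isDerivation_singleton.1 hV.1).1
  have ht : P.IsDerivation (p ++ u₁ ++ q) [⟨p, u₁, v₁, q⟩] (p ++ v₁ ++ q) :=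
    isDerivation_singleton.2 ⟨hc, rfl, rfl⟩
  have h1 := steps_comp (D.comp ((A.sum (Diagram.trivial P u).toClass).sum B))
    (D := ((Diagram.ofDerivation ht).sum (.trivial P u)).sum (.trivial P b'))
    (L := [⟨p, u₁, v₁, q ++ u ++ b'⟩])
    (h := isDerivation_singleton.2 ⟨hc, by simp, by simp⟩)
    (congrArg (Quot.mk _) (Subtype.ext (by simp [DerivStep.addRight])))
  refine ⟨A.comp (Diagram.ofDerivation ht).toClass, B, (hV.unique h1).trans ?_⟩
  rw [DiagramClass.comp_assoc]
  have h2 := DiagramClass.sum_comp_sum (A.sum (Diagram.trivial P u).toClass)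
    ((Diagram.ofDerivation ht).sum (.trivial P u)).toClass B (Diagram.trivial P b').toClass
  have h3 := DiagramClass.sum_comp_sum A (Diagram.ofDerivation ht).toClass
    (Diagram.trivial P u).toClass (Diagram.trivial P u).toClass
  rw [DiagramClass.comp_trivial] at h2 h3
  rw [← h3]
  exact congrArg (Sigma.mk _) (congrArg D.comp h2)

theorem IsTranslate.addLeft {a u b : List α} {D : P.DiagramClass w (a ++ u ++ b)}
    {p u₁ v₁ q a' : List α} {V V' : P.FarleyVertex w}
    (h : IsTranslate D a' (p ++ u₁ ++ q) V) (hV : V.Steps [⟨a' ++ u ++ p, u₁, v₁, q⟩] V') :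
    IsTranslate D a' (p ++ v₁ ++ q) V' := by
  obtain ⟨A, B, rfl⟩ := h
  have hc := (isDerivation_singleton.1 hV.1).1
  have ht : P.IsDerivation (p ++ u₁ ++ q) [⟨p, u₁, v₁, q⟩] (p ++ v₁ ++ q) :=
    isDerivation_singleton.2 ⟨hc, rfl, rfl⟩
  have h1 := steps_comp (D.comp ((A.sum (Diagram.trivial P u).toClass).sum B))
    (D := (Diagram.trivial P (a' ++ u)).sum (Diagram.ofDerivation ht))
    (L := [⟨a' ++ u ++ p, u₁, v₁, q⟩])
    (h := isDerivation_singleton.2 ⟨hc, by simp, by simp⟩)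
    (congrArg (Quot.mk _) (Subtype.ext (by simp [DerivStep.addLeft])))
  refine ⟨A, B.comp (Diagram.ofDerivation ht).toClass, (hV.unique h1).trans ?_⟩
  rw [DiagramClass.comp_assoc]
  have h2 := DiagramClass.sum_comp_sum (A.sum (Diagram.trivial P u).toClass)
    (Diagram.trivial P (a' ++ u)).toClass B (Diagram.ofDerivation ht).toClass
  rw [DiagramClass.comp_trivial] at h2
  exact congrArg (Sigma.mk _) (congrArg D.comp h2)

/-- The edges `[D · (A + ε(u) + B), D · (A + Π + B)]`, where `Π` is a `(u, v)`-cell. -/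
def translateEdges {a u b : List α} (D : P.DiagramClass w (a ++ u ++ b)) (v : List α) :
    Set (Sym2 (P.FarleyVertex w)) :=
  {e | ∃ (a' b' : List α) (V W : P.FarleyVertex w), IsTranslate D a' b' V ∧
    V.Steps [⟨a', u, v, b'⟩] W ∧ e = s(V, W)}

/-- The other cell of the square avoids the subword `u`, so it lies entirely to its right or
entirely to its left, and is absorbed into `B` or `A` respectively. -/
theorem Parallel.mem_translateEdges {a u b v : List α} {D : P.DiagramClass w (a ++ u ++ b)}
    {e f : Sym2 (P.FarleyVertex w)} (h : Parallel w e f) (he : e ∈ translateEdges D v) :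
    f ∈ translateEdges D v := by
  obtain ⟨a', b', V, W, hV, hW, rfl⟩ := he
  obtain ⟨t, s', t', V', W', hi, h1, h2, rfl⟩ := h.exists_steps hW
  generalize hs : (⟨a', u, v, b'⟩ : DerivStep α) = s at hi
  cases hi with
  | left p u₁ v₁ q u' v' r =>
    cases hs
    exact ⟨_, _, V', W', hV.addLeft h1, h2, rfl⟩
  | right p u₁ v₁ q u' v' r =>
    cases hs
    exact ⟨_, _, V', W', hV.addRight h1, h2, rfl⟩

theorem mem_translateEdges_iff_of_eqvGen {a u b v : List α} {D : P.DiagramClass w (a ++ u ++ b)}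
    {e f : Sym2 (P.FarleyVertex w)} (h : Relation.EqvGen (Parallel w) e f) :
    e ∈ translateEdges D v ↔ f ∈ translateEdges D v := by
  induction h with
  | rel _ _ h => exact ⟨h.mem_translateEdges, h.symm.mem_translateEdges⟩
  | refl => rfl
  | symm _ _ _ ih => exact ih.symm
  | trans _ _ _ _ _ ih ih' => exact ih.trans ih'

/-! ### The hyperplane of a minimal diagram and its stabilizer. -/

/-- The edge that ends at the minimal diagram of a hyperplane belongs to the hyperplane. -/
theorem edge_mem_of_isPositiveHalfspace {J : Set (Sym2 (P.FarleyVertex w))} {x z : List α}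
    {D : P.Diagram w x} {A : P.Diagram x z} (hA : A.numCells = 1)
    (hr : (D.comp A).IsReduced) (hJ : IsHalfspace J (D.comp A).upperSet) :
    s(D.toVertex, (D.comp A).toVertex) ∈ J := by
  obtain ⟨C, hC⟩ := hJ
  by_contra h
  have hadj : ((P.farleyGraph w).deleteEdges J).Adj D.toVertex (D.comp A).toVertex :=
    SimpleGraph.deleteEdges_adj.2 ⟨⟨A, hA, rfl⟩, h⟩
  have hmem : (D.comp A).toVertex ∈ C.supp := by
    rw [← hC]
    exact ⟨D.comp A, hr, rfl, .trivial P _, (Diagram.comp_trivial _).symm⟩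
  have hmem' : D.toVertex ∈ C.supp := by
    rw [SimpleGraph.ConnectedComponent.mem_supp_iff] at *
    rw [← hmem]
    exact SimpleGraph.ConnectedComponent.sound hadj.reachable
  rw [← hC] at hmem'
  obtain ⟨E, hE, hE', G, rfl⟩ := hmem'
  -- `(D ∘ A) ∘ G` and `D` are reduced of the same class, hence equal; but `D ∘ A` alone has one
  -- cell more than `D`.
  have h1 : (D.comp A).numCells + G.numCells = D.numCells := (Diagram.numCells_comp _ _).symm.trans
    (congrArg Diagram.numCells (hE.eq_of_toClass_eq hr.of_comp hE'))
  rw [Diagram.numCells_comp] at h1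
  omega

/-- The stabilizer of the hyperplane of the edge `[D, D · (ε(a) + Π + ε(b))]`. -/
theorem hyperplaneStabilizer_eq {J : Set (Sym2 (P.FarleyVertex w))} (hJ : IsHyperplane J)
    {a u v b : List α} {D : P.Diagram w (a ++ u ++ b)} {W : P.FarleyVertex w}
    (hW : D.toVertex.Steps [⟨a, u, v, b⟩] W) (hmem : s(D.toVertex, W) ∈ J) :
    hyperplaneStabilizer J = (P.canonicalHom a u b).range.map (conjHom D) := by
  have hJ' : J = {f | Relation.EqvGen (Parallel w) s(D.toVertex, W) f} := by
    obtain ⟨e, -, rfl⟩ := hJ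
    ext f
    exact ⟨fun hf => (Relation.EqvGen.symm _ _ hmem).trans _ _ _ hf,
      fun hf => Relation.EqvGen.trans _ _ _ hmem hf⟩
  have hconj : ∀ k : P.DiagramGroup (a ++ u ++ b),
      conjHom D k • D.toVertex = ⟨a ++ u ++ b, D.toClass.comp k⟩ := by
    intro k
    refine congrArg (Sigma.mk _) ?_
    change ((D.toClass.comp k).comp D.toClass.inv).comp D.toClass = _
    rw [DiagramClass.comp_assoc, DiagramClass.inv_comp, DiagramClass.comp_trivial]
  ext g
  constructor
  · intro hg
    replace hg : Sym2.map (fun V => g • V) '' J = J := hg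
    have h1 : s(g • D.toVertex, g • W) ∈ J := by
      rw [← hg]
      exact ⟨_, hmem, rfl⟩
    -- The edge itself is the translate by trivial `A` and `B`; membership then propagates to its
    -- image under `g`.
    have h0 : s(D.toVertex, W) ∈ translateEdges D.toClass v :=
      ⟨a, b, _, W, ⟨(Diagram.trivial P a).toClass, (Diagram.trivial P b).toClass,
        congrArg (Sigma.mk _) (DiagramClass.comp_trivial _).symm⟩, hW, rfl⟩
    rw [hJ'] at h1
    obtain ⟨a', b', V, W', ⟨A, B, rfl⟩, hV, he⟩ := (mem_translateEdges_iff_of_eqvGen h1).1 h0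
    have hg1 := hW.smul g
    rcases Sym2.eq_iff.1 he with ⟨h2, h3⟩ | ⟨h2, h3⟩
    · rw [h2, h3] at hg1
      -- The translated edge still carries the step `(a, u, v, b)`, which forces `a' = a` and `b' =
      -- b`.
      have h4 := hg1.step_unique hV
      simp only [DerivStep.mk.injEq, true_and] at h4
      obtain ⟨rfl, rfl⟩ := h4
      refine ⟨P.canonicalHom a u b (A, B), ⟨(A, B), rfl⟩, ?_⟩
      have h5 : g.comp D.toClass = D.toClass.comp (P.canonicalHom a u b (A, B)) :=
        eq_of_heq (Sigma.mk.inj h2).2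
      change (D.toClass.comp _).comp D.toClass.inv = g
      rw [← h5, DiagramClass.comp_assoc, DiagramClass.comp_inv, DiagramClass.comp_trivial]
    -- Reversed orientation would identify a `(u, v)`-cell with a `(v, u)`-cell, although `u ≠ v`.
    · rw [h2, h3] at hg1
      have h4 := hg1.step_unique hV.symm
      have hc := (isDerivation_singleton.1 hW.1).1
      simp only [DerivStep.inv, DerivStep.mk.injEq] at h4
      exact absurd h4.2.1 hc.ne
  · rintro ⟨_, ⟨⟨A, B⟩, rfl⟩, rfl⟩
    set g := conjHom D (P.canonicalHom a u b (A, B)) with hg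
    have key : Relation.EqvGen (Parallel w) s(D.toVertex, W) s(g • D.toVertex, g • W) := by
      induction A using Quot.ind with | mk A =>
      induction B using Quot.ind with | mk B =>
      obtain ⟨L, hL, rfl⟩ := A.exists_ofDerivation
      obtain ⟨M, hM, rfl⟩ := B.exists_ofDerivation
      -- `A + ε(u) + B` is drawn with all cells of `A` first, then those of `B`, matching the two
      -- transport lemmas.
      have hd : P.IsDerivation (a ++ u ++ b) (L.map (DerivStep.addRight (u ++ b)) ++
          M.map (DerivStep.addLeft (a ++ u))) (a ++ u ++ b) :=
        IsDerivation.append (y := a ++ u ++ b) (by simpa using hL.addRight (u ++ b))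
          (hM.addLeft (a ++ u))
      have hs : D.toVertex.Steps (L.map (DerivStep.addRight (u ++ b)) ++
          M.map (DerivStep.addLeft (a ++ u))) (g • D.toVertex) := by
        rw [hg, hconj]
        exact steps_comp D.toClass
          (D := ((Diagram.ofDerivation hL).sum (.trivial P u)).sum (Diagram.ofDerivation hM))
          (h := hd) (congrArg (Quot.mk _) (Subtype.ext
            (by simp [Function.comp_def, DerivStep.addRight])))
      obtain ⟨U, hU, hU'⟩ := steps_append.1 hs
      obtain ⟨W₁, hW₁, h1⟩ := exists_parallel_addRight hL hW hU
      obtain ⟨W₂, hW₂, h2⟩ := exists_parallel_addLeft hM hW₁ hU'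
      obtain rfl := hW₂.unique (hW.smul g)
      exact h1.trans _ _ _ h2
    -- The edge is also parallel to its translate by `g⁻¹`, which gives the inclusion of `J` in its
    -- image under `g`.
    have key' := eqvGen_parallel_smul g⁻¹ key
    simp only [Sym2.map_mk, inv_smul_smul] at key'
    change Sym2.map (fun V => g • V) '' J = J
    rw [hJ']
    ext f
    constructor
    · rintro ⟨f, hf, rfl⟩
      exact key.trans _ _ _ (eqvGen_parallel_smul g hf)
    · intro hf
      refine ⟨f.map fun V => g⁻¹ • V, ?_, ?_⟩
      · exact key'.symm.trans _ _ _ (eqvGen_parallel_smul g⁻¹ hf)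
      · rw [Sym2.map_map]
        simp

end SemigroupPresentation

theorem proposition2p6 {α : Type*} (P : SemigroupPresentation α) (w : List α) (hw : w ≠ [])
    (J : Set (Sym2 (P.FarleyVertex w))) (hJ : SemigroupPresentation.IsHyperplane J)
    (a u v b : List α) (hcell : P.IsCell u v)
    (Δ : P.Diagram w (a ++ v ++ b)) (hΔ : SemigroupPresentation.IsMinimalDiagramOf J Δ)
    (F : P.Diagram (a ++ u ++ b) (a ++ v ++ b))
    (hF : F = ((SemigroupPresentation.Diagram.trivial P a).sum
      (SemigroupPresentation.Diagram.cell hcell)).sum (SemigroupPresentation.Diagram.trivial P b))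
    (hmax : F.IsMaximalThinSuffix Δ)
    (Δbar : P.Diagram w (a ++ u ++ b)) (hΔbar : Δ = Δbar.comp F)
    (ha : ∀ ξ : List α, ξ ≠ [] → ¬ P.EqMod a (a ++ u ++ ξ)) :
    Function.Injective (P.canonicalHom a u b) ∧
      SemigroupPresentation.hyperplaneStabilizer J =
        (P.canonicalHom a u b).range.map (SemigroupPresentation.conjHom Δbar) := by
  refine ⟨SemigroupPresentation.canonicalHom_injective a u b, ?_⟩
  subst hΔbar
  have hd : P.IsDerivation (a ++ u ++ b) [⟨a, u, v, b⟩] (a ++ v ++ b) :=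
    SemigroupPresentation.isDerivation_singleton.2 ⟨hcell, rfl, rfl⟩
  have hF' : F = SemigroupPresentation.Diagram.ofDerivation hd := hF.trans
    (congrArg (Quot.mk _) (Subtype.ext (by simp [DerivStep.addLeft, DerivStep.addRight])))
  -- Since `F` is one step, `[Δbar, Δ]` is an edge labelled `(a, u, v, b)`, and it lies in `J`
  -- because the prefix set of `Δ` is a halfspace.
  exact SemigroupPresentation.hyperplaneStabilizer_eq hJ
    (SemigroupPresentation.FarleyVertex.steps_comp Δbar.toClass hF')
    (SemigroupPresentation.edge_mem_of_isPositiveHalfspace (by rw [hF']; rfl) hΔ.1 hΔ.2.2.1)
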